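/- **Setting.** Let $d\ge 0$ be an integer, $\mathbb T^d=\mathbb R^d/\mathbb Z^d$, let $h:\mathbb T^d\to\mathbb R$ be real analytic, $\lambda\in(0,1)$, and let $\omega\in\mathbb R^d$ satisfy $\langle m,\omega\rangle\notin\mathbb Z$ for all $m\in\mathbb Z^d\setminus\{0\}$. Put $\alpha(x)=\lambda e^{2\pi i h(x)}$ and $\alpha_n(x)=\alpha(x+(n-1)\omega)$ for $x\in\mathbb T^d$, $n\in\mathbb Z$. Write $\rho_j=(1-|\alpha_j|^2)^{1/2}$ and let $\Theta_j=\begin{pmatrix}\bar\alpha_j&\rho_j\\ \rho_j&-\alpha_j\end{pmatrix}$ act on the coordinates $j,j+1$. Let $\mathcal C_x=(\Theta_0\oplus\Theta_2\oplus\cdots)(1\oplus\Theta_1\oplus\Theta_3\oplus\cdots)$ on $\ell^2(\{0,1,2,\dots\})$ be the half-line CMV matrix, and $\mathcal E_x=\big(\bigoplus_{j\text{ even}}\Theta_j\big)\big(\bigoplus_{j\text{ odd}}\Theta_j\big)$ on $\ell^2(\mathbb Z)$ the extended CMV matrix, with coefficients $\alpha_j=\alpha_j(x)$. Let $\mu_x$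 be the canonical maximal spectral measure of $\mathcal C_x$, i.e. its spectral measure at $\delta_0$, and let $\Lambda_x$ be the canonical maximal spectral measure of $\mathcal E_x$, i.e. the sum of its spectral measures at $\delta_0$ and $\delta_1$; both are measures on the unit circle $\partial\mathbb D$, and $\mu_x(a,b)$, $\Lambda_x(a,b)$ denote the measures of the arc $\{e^{i\theta}:a<\theta<b\}$. For $z\in\partial\mathbb D$ let $$A_z(x)=\frac{z^{-1/2}}{\sqrt{1-|\alpha(x)|^2}}\begin{pmatrix}z&-\overline{\alpha(x)}\\-\alpha(x)z&1\end{pmatrix},\qquad A_z^n(x)=A_z(x+(n-1)\omega)\cdots A_z(x),\quad A_z^0=I,$$ and $\|A_z^n\|_0=\sup_{x\in\mathbb T^d}\|A_z^n(x)\|$ with the operator norm on $\mathbb C^2$. For $x\in\mathbb T^d$ and $\phi\in\partial\mathbb D$, let $\mu_{x,\phi}$ be the nontrivial probability measure on $\partial\mathbb D$ with Verblunsky coefficients $(\phi\,\alpha_n(x))_{n\ge0}$ (that is, its monic orthogonal polynomials satisfy $\Phi_{n+1}(z)=z\Phi_n(z)-\overline{\phi\,\alpha_n(x)}\,\Phi_n^*(z)$,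 where $\Phi_n^*(z)=z^n\overline{\Phi_n(1/\bar z)}$), and let $F_x^\phi(z)=\int\frac{w+z}{w-z}\,d\mu_{x,\phi}(w)$ be its Carathéodory function. **Proposition.** There are universal constants $C,c>0$ such that for all $d,h,\lambda,\omega$ as above, every $x\in\mathbb T^d$, every $\zeta\in\mathbb R$ and every $0<\epsilon<1$, with suprema over integers $s$, $$\sup_{\phi\in\partial\mathbb D}\big|F_x^\phi((1-\epsilon)e^{i\zeta})\big|\le C\sup_{0\le s\le c\epsilon^{-1}}\|A^s_{e^{i\zeta}}\|_0^2,$$ $$\mu_x(\zeta-\epsilon,\zeta+\epsilon)\le C\epsilon\sup_{0\le s\le c\epsilon^{-1}}\|A^s_{e^{i\zeta}}\|_0^2,$$ $$\Lambda_x(\zeta-\epsilon,\zeta+\epsilon)\le C\epsilon\sup_{0\le s\le c\epsilon^{-1}}\|A^s_{e^{i\zeta}}\|_0^2.$$ -/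

import Mathlib

open MeasureTheory Polynomial Set Complex
open scoped ComplexConjugate InnerProductSpace lp ENNReal Complex.UnitDisc Matrix.Norms.L2Operator

noncomputable section

instance : MeasurableSpace Circle := borel Circle

instance : BorelSpace Circle := ⟨rfl⟩

section SpectralMeasure

variable {H : Type*} [NormedAddCommGroup H] [InnerProductSpace ℂ H] [CompleteSpace H]

theorem exists_spectralMeasure (U : H ≃ₗᵢ[ℂ] H) (ψ : H) :
    ∃ μ : Measure Circle, IsFiniteMeasure μ ∧
      ∀ n : ℤ, ∫ w : Circle, ((w ^ n : Circle) : ℂ) ∂μ = ⟪ψ, (U ^ n) ψ⟫_ℂ := by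
  set u : unitary (H →L[ℂ] H) := Unitary.linearIsometryEquiv.symm U with hu
  have hn : IsStarNormal (u : H →L[ℂ] H) := inferInstance
  let ι : C(spectrum ℂ (u : H →L[ℂ] H), Circle) :=
    ⟨fun z => ⟨z, by
      have := Unitary.spectrum_subset_circle (𝕜 := ℂ) u z.2
      simpa [Submonoid.unitSphere] using this⟩, by fun_prop⟩
  let Φ : C(Circle, ℂ) →⋆ₐ[ℂ] (H →L[ℂ] H) := (cfcHom hn).comp (ContinuousMap.compStarAlgHom' ℂ ℂ ι)
  let cx : C(Circle, ℝ) → C(Circle, ℂ) := fun f => ⟨fun w => (f w : ℂ), by fun_prop⟩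
  have hpos : ∀ f : C(Circle, ℝ), 0 ≤ f → 0 ≤ RCLike.re ⟪ψ, Φ (cx f) ψ⟫_ℂ := by
    intro f hf
    let g : C(Circle, ℂ) := ⟨fun w => (Real.sqrt (f w) : ℂ), by fun_prop⟩
    have hg : cx f = star g * g := by
      ext w
      simp only [cx, g, ContinuousMap.coe_mk, ContinuousMap.mul_apply, ContinuousMap.star_apply,
        RCLike.star_def, Complex.conj_ofReal]
      have h0 : 0 ≤ f w := hf w
      rw [← Complex.ofReal_mul, Real.mul_self_sqrt h0]
    rw [hg, map_mul, map_star, mul_apply_eq_comp, ContinuousLinearMap.star_eq_adjoint,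
      ContinuousLinearMap.adjoint_inner_right]
    exact inner_self_nonneg
  let Λ : CompactlySupportedContinuousMap Circle ℝ →ₚ[ℝ] ℝ := PositiveLinearMap.mk₀
    { toFun := fun f => RCLike.re ⟪ψ, Φ (cx f) ψ⟫_ℂ
      map_add' := by
        intro f g
        have : cx ((f + g : CompactlySupportedContinuousMap Circle ℝ) : C(Circle, ℝ)) = cx f + cx g := by
          ext w; simp [cx]
        rw [this, map_add, _root_.add_apply, inner_add_right, map_add]
      map_smul' := by
        intro c f
        have : cx ((c • f : CompactlySupportedContinuousMap Circle ℝ) : C(Circle, ℝ)) = (c : ℂ) • cx f := by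
          ext w; simp [cx]
        rw [this, map_smul, _root_.smul_apply, inner_smul_right]
        simp }
    (fun f hf => hpos f (fun w => hf w))
  have hint : ∀ f : C(Circle, ℝ), ∫ w, f w ∂(RealRMK.rieszMeasure Λ) = RCLike.re ⟪ψ, Φ (cx f) ψ⟫_ℂ :=
    fun f => RealRMK.integral_rieszMeasure Λ (CompactlySupportedContinuousMap.continuousMapEquiv f)
  have hreal : ∀ f : C(Circle, ℝ), ⟪ψ, Φ (cx f) ψ⟫_ℂ = ((RCLike.re ⟪ψ, Φ (cx f) ψ⟫_ℂ : ℝ) : ℂ) := by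
    intro f
    have hs : star (cx f) = cx f := by ext w; simp [cx]
    have h2 : star (Φ (cx f)) = Φ (cx f) := by rw [← map_star, hs]
    refine (Complex.conj_eq_iff_re.1 ?_).symm
    rw [inner_conj_symm]
    nth_rw 1 [← h2]
    rw [ContinuousLinearMap.star_eq_adjoint, ContinuousLinearMap.adjoint_inner_left]
  have hfin : IsFiniteMeasure (RealRMK.rieszMeasure Λ) := inferInstance
  refine ⟨RealRMK.rieszMeasure Λ, hfin, fun n => ?_⟩
  have hcplx : ∀ g : C(Circle, ℂ), ∫ w, g w ∂(RealRMK.rieszMeasure Λ) = ⟪ψ, Φ g ψ⟫_ℂ := by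
    intro g
    let a : C(Circle, ℝ) := ⟨fun w => (g w).re, by fun_prop⟩
    let b : C(Circle, ℝ) := ⟨fun w => (g w).im, by fun_prop⟩
    have hg : g = cx a + Complex.I • cx b := by
      ext w
      simp [cx, a, b, mul_comm Complex.I]
    have hi : Integrable (fun w => g w) (RealRMK.rieszMeasure Λ) :=
      g.continuous.integrable_of_hasCompactSupport (HasCompactSupport.of_compactSpace _)
    have e1 := integral_re_add_im (𝕜 := ℂ) hi
    rw [← e1]
    conv_rhs => rw [hg]
    rw [map_add, map_smul, _root_.add_apply, _root_.smul_apply,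
      inner_add_right, inner_smul_right, hreal a, hreal b, ← hint a, ← hint b]
    simp [a, b, mul_comm]
  let p : C(Circle, ℂ) := ⟨fun w => (w : ℂ), by fun_prop⟩
  have hΦp : Φ p = (u : H →L[ℂ] H) := cfcHom_id hn
  have key : ∀ m : ℕ, Φ (p ^ m) = ((u ^ m : unitary (H →L[ℂ] H)) : H →L[ℂ] H) := by
    intro m; rw [map_pow, hΦp]; rfl
  have hUn : ∀ m : ℤ, (U ^ m) ψ = ((u ^ m : unitary (H →L[ℂ] H)) : H →L[ℂ] H) ψ := by
    intro m
    have : U ^ m = Unitary.linearIsometryEquiv (u ^ m) := by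
      rw [map_zpow, hu, MulEquiv.apply_symm_apply]
    rw [this]; rfl
  rw [hUn]
  obtain ⟨m, rfl | rfl⟩ := n.eq_nat_or_neg
  · rw [zpow_natCast, ← key, ← hcplx]
    congr 1
  · rw [zpow_neg, zpow_natCast, ← Unitary.star_eq_inv, Unitary.coe_star, ← key, ← map_star, ← hcplx]
    congr 1
    ext w
    change _ = conj ((w : ℂ) ^ m)
    rw [← Circle.coe_pow, ← Circle.coe_inv_eq_conj, zpow_neg, zpow_natCast]

/-- The spectral measure of the unitary operator `U` at the vector `ψ`: the finite measure on the
unit circle with moments `∫ wⁿ dμ = ⟨ψ, Uⁿ ψ⟩`, `n ∈ ℤ` (these determine it uniquely). -/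
def spectralMeasure (U : H ≃ₗᵢ[ℂ] H) (ψ : H) : Measure Circle :=
  (exists_spectralMeasure U ψ).choose

instance (U : H ≃ₗᵢ[ℂ] H) (ψ : H) : IsFiniteMeasure (spectralMeasure U ψ) :=
  (exists_spectralMeasure U ψ).choose_spec.1

theorem integral_zpow_spectralMeasure (U : H ≃ₗᵢ[ℂ] H) (ψ : H) (n : ℤ) :
    ∫ w : Circle, ((w ^ n : Circle) : ℂ) ∂(spectralMeasure U ψ) = ⟪ψ, (U ^ n) ψ⟫_ℂ :=
  (exists_spectralMeasure U ψ).choose_spec.2 n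

end SpectralMeasure

/-! ### CMV matrices -/

/-- Data for a unitary operator on `ℓ²(ι)` that is a direct sum of `1 × 1` and `2 × 2` blocks, the
blocks being supported on the orbits `{i, σ i}` of an involution `σ`. -/
structure BlockData (ι : Type*) where
  σ : ι → ι
  a : ι → ℂ
  b : ι → ℝ
  invol : ∀ i, σ (σ i) = i
  symm : ∀ i, b (σ i) = b i
  norm_one : ∀ i, conj (a i) * a i + (b i : ℂ) ^ 2 = 1
  orth : ∀ i, (b i : ℂ) * (conj (a i) + a (σ i)) = 0

namespace BlockData

variable {ι : Type*}

/-- The data of the adjoint operator. -/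
def dual (D : BlockData ι) : BlockData ι where
  σ := D.σ
  a := fun i => conj (D.a i)
  b := D.b
  invol := D.invol
  symm := D.symm
  norm_one := fun i => by
    have := D.norm_one i
    rw [Complex.conj_conj, mul_comm]; exact this
  orth := fun i => by
    have := congrArg conj (D.orth i)
    simpa using this

theorem norm_a_le (D : BlockData ι) (i : ι) : ‖D.a i‖ ≤ 1 := by
  have h := D.norm_one i
  rw [← Complex.normSq_eq_conj_mul_self, ← Complex.ofReal_pow, ← Complex.ofReal_add,
    Complex.normSq_eq_norm_sq] at h
  have h' : ‖D.a i‖ ^ 2 + D.b i ^ 2 = 1 := by exact_mod_cast h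
  nlinarith [sq_nonneg (D.b i), norm_nonneg (D.a i)]

theorem norm_b_le (D : BlockData ι) (i : ι) : ‖(D.b i : ℂ)‖ ≤ 1 := by
  have h := D.norm_one i
  rw [← Complex.normSq_eq_conj_mul_self, ← Complex.ofReal_pow, ← Complex.ofReal_add,
    Complex.normSq_eq_norm_sq] at h
  have h' : ‖D.a i‖ ^ 2 + D.b i ^ 2 = 1 := by exact_mod_cast h
  rw [Complex.norm_real, Real.norm_eq_abs, abs_le]
  constructor <;> nlinarith [sq_nonneg (‖D.a i‖)]

theorem memℓp_comp (D : BlockData ι) (u : ℓ²(ι, ℂ)) : Memℓp (fun i => u (D.σ i)) 2 := by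
  have h := (memℓp_gen_iff (p := 2) (by simp)).1 (lp.memℓp u)
  have hinj : Function.Injective D.σ := Function.LeftInverse.injective D.invol
  exact (memℓp_gen_iff (p := 2) (by simp)).2 (h.comp_injective hinj)

theorem memℓp_a (D : BlockData ι) (u : ℓ²(ι, ℂ)) : Memℓp (fun i => D.a i * u i) 2 := by
  refine (lp.memℓp u).mono' fun i => ?_
  rw [norm_mul]
  exact mul_le_of_le_one_left (norm_nonneg _) (D.norm_a_le i)

theorem memℓp_b (D : BlockData ι) (u : ℓ²(ι, ℂ)) :
    Memℓp (fun i => (D.b i : ℂ) * u (D.σ i)) 2 := by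
  refine (D.memℓp_comp u).mono' fun i => ?_
  rw [norm_mul]
  exact mul_le_of_le_one_left (norm_nonneg _) (D.norm_b_le i)

/-- `(T u) i = a i * u i + b i * u (σ i)`. -/
def toLin (D : BlockData ι) : ℓ²(ι, ℂ) →ₗ[ℂ] ℓ²(ι, ℂ) where
  toFun u := ⟨fun i => D.a i * u i + D.b i * u (D.σ i), (D.memℓp_a u).add (D.memℓp_b u)⟩
  map_add' u v := by
    ext i
    simp only [lp.coeFn_add, Pi.add_apply]
    ring
  map_smul' c u := by
    ext i
    simp only [lp.coeFn_smul, Pi.smul_apply, smul_eq_mul, RingHom.id_apply]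
    ring

theorem toLin_apply (D : BlockData ι) (u : ℓ²(ι, ℂ)) (i : ι) :
    D.toLin u i = D.a i * u i + D.b i * u (D.σ i) := rfl

theorem dual_toLin (D : BlockData ι) (u : ℓ²(ι, ℂ)) : D.dual.toLin (D.toLin u) = u := by
  ext i
  rw [toLin_apply, toLin_apply, toLin_apply]
  change conj (D.a i) * (D.a i * u i + D.b i * u (D.σ i)) +
    D.b i * (D.a (D.σ i) * u (D.σ i) + D.b (D.σ i) * u (D.σ (D.σ i))) = u i
  rw [D.invol, D.symm]
  linear_combination u i * D.norm_one i + u (D.σ i) * D.orth i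

theorem inner_toLin (D : BlockData ι) (u v : ℓ²(ι, ℂ)) :
    ⟪D.toLin u, v⟫_ℂ = ⟪u, D.dual.toLin v⟫_ℂ := by
  let P : ℓ²(ι, ℂ) → ℓ²(ι, ℂ) := fun w => ⟨fun i => w (D.σ i), D.memℓp_comp w⟩
  let A : ℓ²(ι, ℂ) := ⟨fun i => D.a i * u i, D.memℓp_a u⟩
  let B : ℓ²(ι, ℂ) := ⟨fun i => D.b i * u (D.σ i), D.memℓp_b u⟩
  let A' : ℓ²(ι, ℂ) := ⟨fun i => conj (D.a i) * v i, D.dual.memℓp_a v⟩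
  let B' : ℓ²(ι, ℂ) := ⟨fun i => D.b i * v (D.σ i), D.memℓp_b v⟩
  have h1 : D.toLin u = A + B := rfl
  have h2 : D.dual.toLin v = A' + B' := rfl
  have hA : ⟪A, v⟫_ℂ = ⟪u, A'⟫_ℂ := by
    rw [lp.inner_eq_tsum, lp.inner_eq_tsum]
    refine tsum_congr fun i => ?_
    change v i * conj (D.a i * u i) = conj (D.a i) * v i * conj (u i)
    rw [map_mul]; ring
  have hB : ⟪B, v⟫_ℂ = ⟪u, B'⟫_ℂ := by
    rw [lp.inner_eq_tsum, lp.inner_eq_tsum]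
    rw [← (Function.Involutive.toPerm D.σ D.invol).tsum_eq]
    refine tsum_congr fun i => ?_
    change v (D.σ i) * conj ((D.b (D.σ i) : ℂ) * u (D.σ (D.σ i))) =
      D.b i * v (D.σ i) * conj (u i)
    rw [D.invol, D.symm, map_mul, Complex.conj_ofReal]; ring
  rw [h1, h2, inner_add_left, inner_add_right, hA, hB]

/-- The direct sum of the blocks as a unitary operator. -/
def toUnitary (D : BlockData ι) : ℓ²(ι, ℂ) ≃ₗᵢ[ℂ] ℓ²(ι, ℂ) where
  toLinearEquiv := LinearEquiv.ofLinearMap D.toLin D.dual.toLin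
    (by
      ext1 u
      have h := D.dual.dual_toLin u
      have hd : D.dual.dual = D := by
        cases D; simp [dual]
      rw [hd] at h
      exact h)
    (by ext1 u; exact D.dual_toLin u)
  norm_map' u := by
    change ‖D.toLin u‖ = ‖u‖
    rw [@norm_eq_sqrt_re_inner ℂ, @norm_eq_sqrt_re_inner ℂ, inner_toLin, dual_toLin]

end BlockData

/-- `ρ = (1 - |α|²)^{1/2}`. -/
def rho (α : 𝔻) : ℝ := √(1 - ‖(α : ℂ)‖ ^ 2)

theorem conj_mul_add_rho_sq (α : 𝔻) : conj (α : ℂ) * α + (rho α : ℂ) ^ 2 = 1 := by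
  rw [← Complex.normSq_eq_conj_mul_self, Complex.normSq_eq_norm_sq, rho, ← Complex.ofReal_pow,
    Real.sq_sqrt (by linarith [α.sq_norm_lt_one])]
  push_cast
  ring

/-- The block `Θ_j = !![conj α_j, ρ_j; ρ_j, -α_j]` acts on the coordinates `j, j + 1`. This is the
direct sum `⨁ Θ_j` over the even integers `j`, the factor `𝓛'` of the extended CMV matrix. -/
def extendedL (α : ℤ → 𝔻) : BlockData ℤ where
  σ n := if Even n then n + 1 else n - 1
  a n := if Even n then conj (α n : ℂ) else -(α (n - 1) : ℂ)
  b n := if Even n then rho (α n) else rho (α (n - 1))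
  invol n := by
    by_cases h : Even n
    · simp [h]
    · simp [h]
  symm n := by
    by_cases h : Even n
    · simp [h]
    · simp [h]
  norm_one n := by
    by_cases h : Even n
    · simpa [h, mul_comm] using conj_mul_add_rho_sq (α n)
    · simpa [h] using conj_mul_add_rho_sq (α (n - 1))
  orth n := by
    by_cases h : Even n
    · have h' : ¬ Even (n + 1) := by rw [Int.even_add_one]; exact not_not.2 h
      simp only [if_pos h, if_neg h', add_sub_cancel_right]
      simp
    · have h' : Even (n - 1) := by rw [Int.even_sub_one]; exact h
      simp only [if_neg h, if_pos h']
      simp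

/-- The direct sum `⨁ Θ_j` over the odd integers `j`, the factor `𝓜'` of the extended CMV
matrix. -/
def extendedM (α : ℤ → 𝔻) : BlockData ℤ where
  σ n := if Even n then n - 1 else n + 1
  a n := if Even n then -(α (n - 1) : ℂ) else conj (α n : ℂ)
  b n := if Even n then rho (α (n - 1)) else rho (α n)
  invol n := by
    by_cases h : Even n
    · simp [h]
    · simp [h]
  symm n := by
    by_cases h : Even n
    · simp [h]
    · simp [h]
  norm_one n := by
    by_cases h : Even n
    · simpa [h] using conj_mul_add_rho_sq (α (n - 1))
    · simpa [h, mul_comm] using conj_mul_add_rho_sq (α n)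
  orth n := by
    by_cases h : Even n
    · have h' : ¬ Even (n - 1) := by rw [Int.even_sub_one]; exact not_not.2 h
      simp only [if_pos h, if_neg h']
      simp
    · have h' : Even (n + 1) := by rw [Int.even_add_one]; exact h
      simp only [if_neg h, if_pos h', add_sub_cancel_right]
      simp

/-- The extended CMV matrix `ℰ = 𝓛' 𝓜'` as a unitary operator on `ℓ²(ℤ)`. -/
def extendedCMV (α : ℤ → 𝔻) : ℓ²(ℤ, ℂ) ≃ₗᵢ[ℂ] ℓ²(ℤ, ℂ) :=
  (extendedL α).toUnitary * (extendedM α).toUnitary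

/-- The factor `𝓛 = Θ₀ ⊕ Θ₂ ⊕ ⋯` of the half-line CMV matrix. -/
def halfLineL (α : ℕ → 𝔻) : BlockData ℕ where
  σ n := if Even n then n + 1 else n - 1
  a n := if Even n then conj (α n : ℂ) else -(α (n - 1) : ℂ)
  b n := if Even n then rho (α n) else rho (α (n - 1))
  invol n := by
    by_cases h : Even n
    · simp [h, Nat.even_add_one]
    · obtain ⟨m, rfl⟩ := Nat.exists_eq_succ_of_ne_zero (n := n) (by rintro rfl; simp at h)
      simp only [Nat.succ_eq_add_one, Nat.even_add_one, not_not] at h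
      simp [h, Nat.even_add_one]
  symm n := by
    by_cases h : Even n
    · simp [h, Nat.even_add_one]
    · obtain ⟨m, rfl⟩ := Nat.exists_eq_succ_of_ne_zero (n := n) (by rintro rfl; simp at h)
      simp only [Nat.succ_eq_add_one, Nat.even_add_one, not_not] at h
      simp [h, Nat.even_add_one]
  norm_one n := by
    by_cases h : Even n
    · simpa [h, mul_comm] using conj_mul_add_rho_sq (α n)
    · simpa [h] using conj_mul_add_rho_sq (α (n - 1))
  orth n := by
    by_cases h : Even n
    · simp [h, Nat.even_add_one]
    · obtain ⟨m, rfl⟩ := Nat.exists_eq_succ_of_ne_zero (n := n) (by rintro rfl; simp at h)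
      simp only [Nat.succ_eq_add_one, Nat.even_add_one, not_not] at h
      simp [h, Nat.even_add_one]

/-- The factor `𝓜 = 1 ⊕ Θ₁ ⊕ Θ₃ ⊕ ⋯` of the half-line CMV matrix. -/
def halfLineM (α : ℕ → 𝔻) : BlockData ℕ where
  σ n := if n = 0 then 0 else if Even n then n - 1 else n + 1
  a n := if n = 0 then 1 else if Even n then -(α (n - 1) : ℂ) else conj (α n : ℂ)
  b n := if n = 0 then 0 else if Even n then rho (α (n - 1)) else rho (α n)
  invol n := by
    rcases n with _ | m
    · simp
    · by_cases h : Even m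
      · simp [h, Nat.even_add_one]
      · have hm : m ≠ 0 := by rintro rfl; simp at h
        simp [h, hm, Nat.even_add_one]
  symm n := by
    rcases n with _ | m
    · simp
    · by_cases h : Even m
      · simp [h, Nat.even_add_one]
      · have hm : m ≠ 0 := by rintro rfl; simp at h
        simp [h, hm, Nat.even_add_one]
  norm_one n := by
    rcases n with _ | m
    · simp
    · by_cases h : Even (m + 1)
      · simpa [h] using conj_mul_add_rho_sq (α m)
      · simpa [h, mul_comm] using conj_mul_add_rho_sq (α (m + 1))
  orth n := by
    rcases n with _ | m
    · simp
    · by_cases h : Even m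
      · simp [h, Nat.even_add_one]
      · have hm : m ≠ 0 := by rintro rfl; simp at h
        simp [h, hm, Nat.even_add_one]

/-- The (half-line) CMV matrix `𝓒 = 𝓛 𝓜` as a unitary operator on `ℓ²(ℤ₊)`, `ℤ₊ = {0, 1, …}`. -/
def halfLineCMV (α : ℕ → 𝔻) : ℓ²(ℕ, ℂ) ≃ₗᵢ[ℂ] ℓ²(ℕ, ℂ) :=
  (halfLineL α).toUnitary * (halfLineM α).toUnitary

/-- The canonical maximal spectral measure `μ` of the half-line CMV matrix: its spectral measure at
the cyclic vector `δ₀`. -/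
def halfLineMeasure (α : ℕ → 𝔻) : Measure Circle :=
  spectralMeasure (halfLineCMV α) (lp.single 2 0 1)

/-- The canonical maximal spectral measure `Λ` of the extended CMV matrix: the sum of its spectral
measures at `δ₀` and `δ₁`. -/
def extendedMeasure (α : ℤ → 𝔻) : Measure Circle :=
  spectralMeasure (extendedCMV α) (lp.single 2 0 1) +
    spectralMeasure (extendedCMV α) (lp.single 2 1 1)

/-! ### Orthogonal polynomials on the unit circle -/

/-- The dual `P^*(z) = zⁿ conj (P (1 / conj z))` of a polynomial `P` of degree at most `n`: the
coefficients are conjugated and reversed. -/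
def szegoDual (n : ℕ) (P : ℂ[X]) : ℂ[X] := (P.map (starRingEnd ℂ)).reflect n

/-- `ν` is a nontrivial (i.e. not supported on a finite set) measure on the unit circle whose
Verblunsky coefficients are `α`: its monic orthogonal polynomials `Φ_n` satisfy
`Φ_{n+1} = z Φ_n - conj α_n Φ_n^*`. -/
def HasVerblunskyCoefficients (ν : Measure Circle) (α : ℕ → 𝔻) : Prop :=
  (∀ S : Set Circle, S.Finite → ν Sᶜ ≠ 0) ∧
  ∃ Φ : ℕ → ℂ[X],
    (∀ n, (Φ n).Monic ∧ (Φ n).natDegree = n ∧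
      ∀ k < n, ∫ w : Circle, conj ((w : ℂ) ^ k) * (Φ n).eval (w : ℂ) ∂ν = 0) ∧
    ∀ n, Φ (n + 1) = X * Φ n - C (conj (α n : ℂ)) * szegoDual n (Φ n)

/-- The Carathéodory function `F(z) = ∫ (w + z) / (w - z) dν(w)` of a measure on the circle. -/
def caratheodory (ν : Measure Circle) (z : ℂ) : ℂ :=
  ∫ w : Circle, ((w : ℂ) + z) / ((w : ℂ) - z) ∂ν

/-! ### Quasi-periodic Verblunsky coefficients and the Szegő cocycle -/

/-- `h : 𝕋^d → ℝ` is real analytic, i.e. its lift to `ℝ^d` is. -/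
def IsAnalyticOnTorus {d : ℕ} (h : UnitAddTorus (Fin d) → ℝ) : Prop :=
  AnalyticOnNhd ℝ (fun y : Fin d → ℝ => h (fun i => (y i : UnitAddCircle))) univ

/-- `⟨m, ω⟩ ∉ ℤ` for all `m ∈ ℤ^d \ {0}`. -/
def RationallyIndependent {d : ℕ} (ω : Fin d → ℝ) : Prop :=
  ∀ m : Fin d → ℤ, m ≠ 0 → ∀ k : ℤ, ∑ i, (m i : ℝ) * ω i ≠ k

/-- The class of `y ∈ ℝ^d` in `𝕋^d = ℝ^d / ℤ^d`. -/
def toTorus {d : ℕ} (y : Fin d → ℝ) : UnitAddTorus (Fin d) := fun i => (y i : UnitAddCircle)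

/-- The sampling function `α(x) = λ exp (2 π i h(x))`, `λ ∈ (0, 1)`. -/
def sampling {d : ℕ} (lam : Ioo (0 : ℝ) 1) (h : UnitAddTorus (Fin d) → ℝ)
    (x : UnitAddTorus (Fin d)) : 𝔻 :=
  UnitDisc.mk ((lam : ℝ) * Complex.exp (2 * Real.pi * I * (h x : ℂ))) (by
    have h1 : ‖Complex.exp (2 * Real.pi * I * (h x : ℂ))‖ = 1 := by
      rw [Complex.norm_exp]; simp
    rw [norm_mul, h1, mul_one, Complex.norm_real, Real.norm_of_nonneg lam.2.1.le]
    exact lam.2.2)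

/-- The Verblunsky coefficients `α_n(x) = α(x + (n - 1) ω)`, `n ∈ ℤ`. -/
def verblunsky {d : ℕ} (α : UnitAddTorus (Fin d) → 𝔻) (ω : Fin d → ℝ)
    (x : UnitAddTorus (Fin d)) (n : ℤ) : 𝔻 :=
  α (x + (n - 1) • toTorus ω)

/-- The renormalized Szegő matrix
`S(α, z) = z^{-1/2} (1 - |α|²)^{-1/2} !![z, -conj α; -α z, 1]`. -/
def szegoMatrix (α : 𝔻) (z : ℂ) : Matrix (Fin 2) (Fin 2) ℂ :=
  (z ^ (-(1 / 2) : ℂ) * ((rho α)⁻¹ : ℝ)) • !![z, -conj (α : ℂ); -(α : ℂ) * z, 1]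

/-- The iterates `A_z^n(x) = A_z(x + (n - 1) ω) ⋯ A_z(x)` of the cocycle `A_z = S(α(·), z)`. -/
def cocycle {d : ℕ} (α : UnitAddTorus (Fin d) → 𝔻) (ω : Fin d → ℝ) (z : ℂ) :
    ℕ → UnitAddTorus (Fin d) → Matrix (Fin 2) (Fin 2) ℂ
  | 0, _ => 1
  | n + 1, x => szegoMatrix (α (x + n • toTorus ω)) z * cocycle α ω z n x

/-- `‖A_z^n‖₀ = sup_x ‖A_z^n(x)‖`, where `‖·‖` is the operator norm on `ℂ²`. -/
def cocycleNorm {d : ℕ} (α : UnitAddTorus (Fin d) → 𝔻) (ω : Fin d → ℝ) (z : ℂ) (n : ℕ) : ℝ :=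
  ⨆ x, ‖cocycle α ω z n x‖

/-- `sup_{0 ≤ s ≤ R} ‖A_z^s‖₀²`, the supremum being over integers `s`. -/
def cocycleGrowth {d : ℕ} (α : UnitAddTorus (Fin d) → 𝔻) (ω : Fin d → ℝ) (z : ℂ) (R : ℝ) : ℝ :=
  ⨆ s : {s : ℕ // (s : ℝ) ≤ R}, cocycleNorm α ω z s ^ 2

/-- The arc `{e^{iθ} : a < θ < b}` of the unit circle. -/
def arc (a b : ℝ) : Set Circle := Circle.exp '' Ioo a b

end

/-! All three bounds rest on one inequality of Jitomirskaya–Last type. Let `z = (1 - ε) z₀`. The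
Carathéodory function `F` at `z` is read off from the initial value of a solution `x` of the Szegő
recursion at `z`, with `|F| ≲ 1 + |x₀|`, and an energy identity gives `ε ∑ |xₙ|² ≲ |F|`. If moreover
`|x₀|² ≲ ε B ∑ |xₙ|²`, where `B ≥ 1` bounds the squared transfer matrices at `z₀` up to time `ε⁻¹`,
then `|F|² ≲ B |F|` once `|F| > 2`, so `|F| ≲ B`.

The missing inequality is `vecSq_le_of_perturbed`. Moving from `z₀` to `z` multiplies each
normalized Szegő matrix by a diagonal matrix within `2 ε` of the identity, so `x` is a perturbed
orbit of the products `Tₙ` at `z₀`. Variation of constants has kernel `Tₙ Tⱼ⁻¹`, and since `|det Tⱼ|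
= 1` the double sum of its squared Frobenius norms is exactly twice the determinant of the Gram
matrix `G = ∑ Tₙ* Tₙ`. Stopping, with a fractional last term, when `det G = 1 / (32 ε²)` keeps the
perturbation harmless, whence `⟨G x₀, x₀⟩ ≤ 3 ∑ |xₙ|²`. Conversely `⟨G x₀, x₀⟩ ≥ (det G / tr G)
|x₀|²` and `tr G ≤ (L + 1) B`, the stopping index `L` being below `ε⁻¹` because `det G ≥ L²`.

For CMV matrices `x` is built from the resolvent vector (`isSzegoSolution_cmvVec`) and the energy
identity is unitarity (`resolvent_norm_sq`). For the measures with rotated coefficients `x` is the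
Weyl solution (`weylCoord_succ`) and the energy identity is the growth of an indefinite form
(`isSzegoSolution_step`). The Poisson kernel turns bounds on `F` into bounds on arcs
(`measure_arc_le`). -/

/-! ### Perturbation of products of `2 × 2` matrices -/

/-- The squared Frobenius norm of a `2 × 2` matrix. -/
noncomputable def frobSq (A : Matrix (Fin 2) (Fin 2) ℂ) : ℝ :=
  normSq (A 0 0) + normSq (A 0 1) + normSq (A 1 0) + normSq (A 1 1)

/-- The squared Euclidean norm of a vector in `ℂ²`. -/
noncomputable def vecSq (v : Fin 2 → ℂ) : ℝ := normSq (v 0) + normSq (v 1)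

theorem vecSq_nonneg (v : Fin 2 → ℂ) : 0 ≤ vecSq v :=
  add_nonneg (normSq_nonneg _) (normSq_nonneg _)

theorem frobSq_nonneg (A : Matrix (Fin 2) (Fin 2) ℂ) : 0 ≤ frobSq A := by
  unfold frobSq
  have := normSq_nonneg (A 0 0)
  have := normSq_nonneg (A 0 1)
  have := normSq_nonneg (A 1 0)
  have := normSq_nonneg (A 1 1)
  positivity

theorem normSq_add_le (x y : ℂ) : normSq (x + y) ≤ 2 * normSq x + 2 * normSq y := by
  simp only [normSq_apply, add_re, add_im]
  nlinarith [sq_nonneg (x.re - y.re), sq_nonneg (x.im - y.im)]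

theorem normSq_mul_add_mul_le (a b x y : ℂ) :
    normSq (a * x + b * y) ≤ (normSq a + normSq b) * (normSq x + normSq y) := by
  have h : normSq (a * x + b * y) + normSq (a * conj y - b * conj x) =
      (normSq a + normSq b) * (normSq x + normSq y) := by
    simp only [normSq_apply, add_re, add_im, sub_re, sub_im, mul_re, mul_im, conj_re, conj_im]
    ring
  linarith [normSq_nonneg (a * conj y - b * conj x)]

theorem normSq_sum_le {ι : Type*} (s : Finset ι) (a b x y : ι → ℂ) :
    normSq (∑ j ∈ s, (a j * x j + b j * y j)) ≤
      (∑ j ∈ s, (normSq (a j) + normSq (b j))) * ∑ j ∈ s, (normSq (x j) + normSq (y j)) := by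
  rw [normSq_eq_norm_sq]
  have h1 : ‖∑ j ∈ s, (a j * x j + b j * y j)‖ ≤
      ∑ j ∈ s, √(normSq (a j) + normSq (b j)) * √(normSq (x j) + normSq (y j)) := by
    refine norm_sum_le_of_le _ fun j _ => ?_
    rw [← Real.sqrt_mul (add_nonneg (normSq_nonneg _) (normSq_nonneg _))]
    refine Real.le_sqrt_of_sq_le ?_
    rw [← normSq_eq_norm_sq]
    exact normSq_mul_add_mul_le _ _ _ _
  refine (pow_le_pow_left₀ (norm_nonneg _) h1 2).trans ?_
  refine (Finset.sum_mul_sq_le_sq_mul_sq _ _ _).trans (le_of_eq ?_)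
  congr 1 <;> refine Finset.sum_congr rfl fun j _ => ?_ <;>
    exact Real.sq_sqrt (add_nonneg (normSq_nonneg _) (normSq_nonneg _))

theorem vecSq_sum_mulVec_le {ι : Type*} (s : Finset ι) (A : ι → Matrix (Fin 2) (Fin 2) ℂ)
    (v : ι → Fin 2 → ℂ) :
    vecSq (∑ j ∈ s, (A j).mulVec (v j)) ≤ (∑ j ∈ s, frobSq (A j)) * ∑ j ∈ s, vecSq (v j) := by
  have h0 := normSq_sum_le s (fun j => A j 0 0) (fun j => A j 0 1) (fun j => v j 0) (fun j => v j 1)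
  have h1 := normSq_sum_le s (fun j => A j 1 0) (fun j => A j 1 1) (fun j => v j 0) (fun j => v j 1)
  have hs : ∑ j ∈ s, frobSq (A j) = (∑ j ∈ s, (normSq (A j 0 0) + normSq (A j 0 1))) +
      ∑ j ∈ s, (normSq (A j 1 0) + normSq (A j 1 1)) := by
    rw [← Finset.sum_add_distrib]
    exact Finset.sum_congr rfl fun j _ => by unfold frobSq; ring
  rw [hs, add_mul]
  simp only [vecSq, Finset.sum_apply, Matrix.mulVec, dotProduct, Fin.sum_univ_two]
  exact add_le_add h0 h1

theorem vecSq_add_le (x y : Fin 2 → ℂ) : vecSq (x + y) ≤ 2 * vecSq x + 2 * vecSq y := by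
  have h0 := normSq_add_le (x 0) (y 0)
  have h1 := normSq_add_le (x 1) (y 1)
  simp only [vecSq, Pi.add_apply]
  linarith

theorem two_le_frobSq {A : Matrix (Fin 2) (Fin 2) ℂ} (h : ‖A.det‖ = 1) : 2 ≤ frobSq A := by
  rw [Matrix.det_fin_two] at h
  have h1 := norm_sub_le (A 0 0 * A 1 1) (A 0 1 * A 1 0)
  rw [h, norm_mul, norm_mul] at h1
  simp only [frobSq, normSq_eq_norm_sq]
  nlinarith [sq_nonneg (‖A 0 0‖ - ‖A 1 1‖), sq_nonneg (‖A 0 1‖ - ‖A 1 0‖)]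

/-! ### Gram matrices of the unperturbed solutions. -/

/-- The inner product of the two columns of a matrix. -/
noncomputable def colInner (A : Matrix (Fin 2) (Fin 2) ℂ) : ℂ := conj (A 0 0) * A 0 1 + conj (A 1 0) * A 1 1

/-- The squared norm of a column of a matrix. -/
noncomputable def colSq (A : Matrix (Fin 2) (Fin 2) ℂ) (i : Fin 2) : ℝ := vecSq fun k => A k i

theorem frobSq_eq_colSq (A : Matrix (Fin 2) (Fin 2) ℂ) : frobSq A = colSq A 0 + colSq A 1 := by
  simp only [frobSq, colSq, vecSq]; ring

/-- Up to a phase `B⁻¹` is the adjugate of `B`, so the left side is `tr (A*A · adj (B*B))`, the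
polarization of the determinant on Hermitian `2 × 2` matrices. -/
theorem frobSq_mul_inv (A : Matrix (Fin 2) (Fin 2) ℂ) {B : Matrix (Fin 2) (Fin 2) ℂ}
    (h : ‖B.det‖ = 1) :
    frobSq (A * B⁻¹) = colSq A 0 * colSq B 1 + colSq A 1 * colSq B 0 -
      2 * ((colInner A).re * (colInner B).re + (colInner A).im * (colInner B).im) := by
  have hu : normSq (Ring.inverse B.det) = 1 := by
    rw [Ring.inverse_eq_inv', normSq_eq_norm_sq, norm_inv, h]; norm_num
  rw [Matrix.inv_def, Matrix.mul_smul]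
  have hs : ∀ (c : ℂ) (M : Matrix (Fin 2) (Fin 2) ℂ), frobSq (c • M) = normSq c * frobSq M := by
    intro c M
    simp only [frobSq, Matrix.smul_apply, smul_eq_mul, normSq_mul]; ring
  rw [hs, hu, one_mul, Matrix.adjugate_fin_two]
  simp [frobSq, colSq, colInner, vecSq, Matrix.mul_apply, Fin.sum_univ_two, normSq_apply]
  ring

theorem vecSq_mulVec (A : Matrix (Fin 2) (Fin 2) ℂ) (g : Fin 2 → ℂ) :
    vecSq (A.mulVec g) = colSq A 0 * normSq (g 0) + colSq A 1 * normSq (g 1) +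
      2 * ((colInner A).re * (conj (g 0) * g 1).re - (colInner A).im * (conj (g 0) * g 1).im) := by
  simp [colSq, colInner, vecSq, Matrix.mulVec, dotProduct, Fin.sum_univ_two, normSq_apply]
  ring

/-- A lower bound for a Hermitian form on `ℂ²` by the quotient of its determinant and trace. -/
theorem det_mul_le_trace_mul_form (P S a b : ℝ) (x y : ℂ) :
    (P * S - a ^ 2 - b ^ 2) * (normSq x + normSq y) ≤
      (P + S) * (P * normSq x + S * normSq y +
        2 * (a * (conj x * y).re - b * (conj x * y).im)) := by
  -- Cayley–Hamilton for the Hermitian matrix `H` with diagonal `P, S` and corner `a + ib`: `tr H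
  -- ⟨Hv, v⟩ = det H |v|² + |Hv|²`. The last two terms are `|Hv|²`.
  have h : (P + S) * (P * normSq x + S * normSq y +
        2 * (a * (conj x * y).re - b * (conj x * y).im)) =
      (P * S - a ^ 2 - b ^ 2) * (normSq x + normSq y) +
        normSq (P * x + ⟨a, b⟩ * y) + normSq (⟨a, -b⟩ * x + S * y) := by
    simp [normSq_apply]
    ring
  rw [h]
  linarith [normSq_nonneg (P * x + ⟨a, b⟩ * y), normSq_nonneg (⟨a, -b⟩ * x + S * y)]

/-- The products `S (n - 1) * ⋯ * S 0`. -/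
noncomputable def transfer (S : ℕ → Matrix (Fin 2) (Fin 2) ℂ) : ℕ → Matrix (Fin 2) (Fin 2) ℂ
  | 0 => 1
  | n + 1 => S n * transfer S n

theorem norm_det_transfer {S : ℕ → Matrix (Fin 2) (Fin 2) ℂ} (hS : ∀ n, ‖(S n).det‖ = 1) (n : ℕ) :
    ‖(transfer S n).det‖ = 1 := by
  induction n with
  | zero => simp [transfer]
  | succ n ih => rw [transfer, Matrix.det_mul, norm_mul, hS, ih, one_mul]

theorem isUnit_det_transfer {S : ℕ → Matrix (Fin 2) (Fin 2) ℂ} (hS : ∀ n, ‖(S n).det‖ = 1)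
    (n : ℕ) : IsUnit (transfer S n).det := by
  rw [isUnit_iff_ne_zero, ← norm_ne_zero_iff, norm_det_transfer hS]
  exact one_ne_zero

/-- Variation of constants. -/
theorem perturbed_eq {S : ℕ → Matrix (Fin 2) (Fin 2) ℂ} (hS : ∀ n, ‖(S n).det‖ = 1)
    {v d : ℕ → Fin 2 → ℂ} (hv : ∀ n, v (n + 1) = (S n).mulVec (v n + d n)) (n : ℕ) :
    v n = (transfer S n).mulVec (v 0) +
      ∑ j ∈ Finset.range n, (transfer S n * (transfer S j)⁻¹).mulVec (d j) := by
  induction n with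
  | zero => simp [transfer]
  | succ n ih =>
    rw [hv, Matrix.mulVec_add, ih, Matrix.mulVec_add, Matrix.mulVec_mulVec, Finset.sum_range_succ,
      transfer, Matrix.mul_assoc (S n) (transfer S n) (transfer S n)⁻¹,
      Matrix.mul_nonsing_inv _ (isUnit_det_transfer hS n), mul_one, add_assoc]
    congr 2
    rw [Matrix.mulVec_sum]
    refine Finset.sum_congr rfl fun j _ => ?_
    rw [Matrix.mulVec_mulVec, Matrix.mul_assoc]

/-- The determinant of the weighted Gram matrix of the two basic solutions. -/
noncomputable def gramDet (S : ℕ → Matrix (Fin 2) (Fin 2) ℂ) (w : ℕ → ℝ) (L : ℕ) : ℝ :=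
  (∑ n ∈ Finset.range L, w n * colSq (transfer S n) 0) *
    (∑ n ∈ Finset.range L, w n * colSq (transfer S n) 1) -
  (∑ n ∈ Finset.range L, w n * (colInner (transfer S n)).re) ^ 2 -
  (∑ n ∈ Finset.range L, w n * (colInner (transfer S n)).im) ^ 2

/-- A polarized determinant summed over both arguments is twice the determinant of the sum. Thus the
quantity controlling the perturbation also controls the Gram form from below. -/
theorem sum_frobSq_eq_gramDet {S : ℕ → Matrix (Fin 2) (Fin 2) ℂ} (hS : ∀ n, ‖(S n).det‖ = 1)
    (w : ℕ → ℝ) (L : ℕ) :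
    ∑ n ∈ Finset.range L, ∑ j ∈ Finset.range L,
      w n * w j * frobSq (transfer S n * (transfer S j)⁻¹) = 2 * gramDet S w L := by
  have h : ∀ n j, w n * w j * frobSq (transfer S n * (transfer S j)⁻¹) =
      (w n * colSq (transfer S n) 0) * (w j * colSq (transfer S j) 1) +
      (w n * colSq (transfer S n) 1) * (w j * colSq (transfer S j) 0) -
      2 * ((w n * (colInner (transfer S n)).re) * (w j * (colInner (transfer S j)).re)) -
      2 * ((w n * (colInner (transfer S n)).im) * (w j * (colInner (transfer S j)).im)) := by
    intro n j
    rw [frobSq_mul_inv _ (norm_det_transfer hS j)]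
    ring
  simp only [h, Finset.sum_sub_distrib, Finset.sum_add_distrib, ← Finset.mul_sum,
    ← Finset.sum_mul, gramDet]
  ring

/-- Each `Tₙ Tⱼ⁻¹` has determinant of modulus one, hence squared Frobenius norm at least `2`. This
limits the stopping index. -/
theorem sq_le_gramDet {S : ℕ → Matrix (Fin 2) (Fin 2) ℂ} (hS : ∀ n, ‖(S n).det‖ = 1) (L : ℕ) :
    (L : ℝ) ^ 2 ≤ gramDet S (fun _ => 1) L := by
  have h := sum_frobSq_eq_gramDet hS (fun _ => 1) L
  have h2 : ∑ n ∈ Finset.range L, ∑ j ∈ Finset.range L, (2 : ℝ) ≤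
      ∑ n ∈ Finset.range L, ∑ j ∈ Finset.range L,
        1 * 1 * frobSq (transfer S n * (transfer S j)⁻¹) := by
    refine Finset.sum_le_sum fun n _ => Finset.sum_le_sum fun j _ => ?_
    rw [one_mul, one_mul]
    refine two_le_frobSq ?_
    rw [Matrix.det_mul, norm_mul, norm_det_transfer hS, one_mul]
    have := congrArg norm (Matrix.det_nonsing_inv_mul_det _ (isUnit_det_transfer hS j))
    rwa [norm_mul, norm_det_transfer hS, mul_one, norm_one] at this
  rw [h] at h2
  simp at h2
  nlinarith

/-! ### The stopping scale and the perturbation estimate. -/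

/-- The weight that is `1` on `[0, L)` and `t` at `L`. -/
noncomputable def stepWeight (L : ℕ) (t : ℝ) (n : ℕ) : ℝ := if n < L then 1 else t

theorem sum_stepWeight (L : ℕ) (t : ℝ) (f : ℕ → ℝ) :
    ∑ n ∈ Finset.range (L + 1), stepWeight L t n * f n = ∑ n ∈ Finset.range L, f n + t * f L := by
  rw [Finset.sum_range_succ]
  congr 1
  · refine Finset.sum_congr rfl fun n hn => ?_
    rw [stepWeight, if_pos (Finset.mem_range.1 hn), one_mul]
  · rw [stepWeight, if_neg (lt_irrefl _)]

/-- The determinant may jump over `K` at an integer; raising the weight of the last index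
continuously from `0` to `1` hits `K` exactly. An exact value is wanted because `K` serves both as
an upper and as a lower bound. -/
theorem exists_gramDet_eq {S : ℕ → Matrix (Fin 2) (Fin 2) ℂ} (hS : ∀ n, ‖(S n).det‖ = 1)
    {K : ℝ} (hK : 1 ≤ K) :
    ∃ (L : ℕ) (t : ℝ), 0 ≤ t ∧ t ≤ 1 ∧ (L : ℝ) ^ 2 ≤ K ∧ gramDet S (stepWeight L t) (L + 1) = K := by
  classical
  have hex : ∃ n : ℕ, K < gramDet S (fun _ => 1) (n + 1) := by
    obtain ⟨n, hn⟩ := exists_nat_gt K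
    refine ⟨n, lt_of_lt_of_le ?_ (sq_le_gramDet hS _)⟩
    push_cast
    nlinarith
  set L := Nat.find hex with hL
  have h1 : K < gramDet S (fun _ => 1) (L + 1) := Nat.find_spec hex
  have h0 : gramDet S (fun _ => 1) L ≤ K := by
    rcases Nat.eq_zero_or_pos L with h | h
    · rw [h]; simp [gramDet]; linarith
    · have := Nat.find_min hex (m := L - 1) (by omega)
      rw [not_lt, Nat.sub_add_cancel h] at this
      exact this
  have hcont : Continuous fun t : ℝ => gramDet S (stepWeight L t) (L + 1) := by
    simp only [gramDet, sum_stepWeight]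
    fun_prop
  have e0 : gramDet S (stepWeight L 0) (L + 1) = gramDet S (fun _ => 1) L := by
    simp only [gramDet, sum_stepWeight, zero_mul, add_zero, one_mul]
  have e1 : gramDet S (stepWeight L 1) (L + 1) = gramDet S (fun _ => 1) (L + 1) := by
    simp only [gramDet, sum_stepWeight, one_mul]
    simp only [Finset.sum_range_succ]
  obtain ⟨t, ht, hKt⟩ := intermediate_value_Icc (zero_le_one' ℝ) hcont.continuousOn
    (show K ∈ Icc _ _ from ⟨by rw [e0]; exact h0, by rw [e1]; exact h1.le⟩)
  exact ⟨L, t, ht.1, ht.2, (sq_le_gramDet hS L).trans h0, hKt⟩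

/-- By variation of constants and Cauchy–Schwarz the weighted sum of the errors is at most `2 δ
gramDet` times that of `|vₙ|²`, so at most a quarter of it. -/
theorem sum_unperturbed_le {S : ℕ → Matrix (Fin 2) (Fin 2) ℂ} (hS : ∀ n, ‖(S n).det‖ = 1)
    {v d : ℕ → Fin 2 → ℂ} (hv : ∀ n, v (n + 1) = (S n).mulVec (v n + d n)) {δ : ℝ}
    (hd : ∀ n, vecSq (d n) ≤ δ * vecSq (v n)) (hδ : 0 ≤ δ) {L : ℕ} {t : ℝ} (ht : 0 ≤ t)
    (hK : δ * (2 * gramDet S (stepWeight L t) (L + 1)) ≤ 1 / 4) :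
    ∑ n ∈ Finset.range (L + 1), stepWeight L t n * vecSq ((transfer S n).mulVec (v 0)) ≤
      3 * ∑ n ∈ Finset.range (L + 1), stepWeight L t n * vecSq (v n) := by
  set w := stepWeight L t with hw
  have hw0 : ∀ n, 0 ≤ w n := by
    intro n
    rw [hw, stepWeight]
    split_ifs <;> linarith
  have hwL : ∀ n < L, w n = 1 := fun n hn => by rw [hw, stepWeight, if_pos hn]
  set k : ℕ → ℕ → ℝ := fun n j => frobSq (transfer S n * (transfer S j)⁻¹) with hk
  have hk0 : ∀ n j, 0 ≤ k n j := fun n j => frobSq_nonneg _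
  set V := ∑ n ∈ Finset.range (L + 1), w n * vecSq (v n) with hV
  -- Only the index `L` can have weight below one, and `j < n ≤ L` never reaches it.
  have hmono : ∀ n ∈ Finset.range (L + 1), ∀ f : ℕ → ℝ, (∀ j, 0 ≤ f j) →
      ∑ j ∈ Finset.range n, f j ≤ ∑ j ∈ Finset.range (L + 1), w j * f j := by
    intro n hn f hf
    have hn' := Finset.mem_range.1 hn
    calc ∑ j ∈ Finset.range n, f j = ∑ j ∈ Finset.range n, w j * f j := by
          refine Finset.sum_congr rfl fun j hj => ?_
          rw [hwL j (by have := Finset.mem_range.1 hj; omega), one_mul]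
      _ ≤ _ := Finset.sum_le_sum_of_subset_of_nonneg
          (Finset.range_subset_range.2 (by omega)) fun j _ _ => mul_nonneg (hw0 j) (hf j)
  have hdiff : ∀ n ∈ Finset.range (L + 1),
      vecSq ((transfer S n).mulVec (v 0)) ≤ 2 * vecSq (v n) +
        2 * ((∑ j ∈ Finset.range (L + 1), w j * k n j) * (δ * V)) := by
    intro n hn
    have e : (transfer S n).mulVec (v 0) = v n +
        -∑ j ∈ Finset.range n, (transfer S n * (transfer S j)⁻¹).mulVec (d j) := by
      rw [perturbed_eq hS hv n]; abel
    rw [e]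
    refine (vecSq_add_le _ _).trans ?_
    have hneg : ∀ x : Fin 2 → ℂ, vecSq (-x) = vecSq x := fun x => by simp [vecSq]
    rw [hneg]
    have h1 := vecSq_sum_mulVec_le (Finset.range n)
      (fun j => transfer S n * (transfer S j)⁻¹) d
    have h2 : ∑ j ∈ Finset.range n, vecSq (d j) ≤ δ * V := by
      calc ∑ j ∈ Finset.range n, vecSq (d j) ≤ ∑ j ∈ Finset.range n, δ * vecSq (v j) :=
            Finset.sum_le_sum fun j _ => hd j
        _ = δ * ∑ j ∈ Finset.range n, vecSq (v j) := by rw [Finset.mul_sum]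
        _ ≤ δ * V := mul_le_mul_of_nonneg_left (hmono n hn _ fun j => vecSq_nonneg _) hδ
    have h3 := hmono n hn (k n) (hk0 n)
    have h4 := mul_le_mul h3 h2 (Finset.sum_nonneg fun j _ => vecSq_nonneg _)
      (Finset.sum_nonneg fun j _ => mul_nonneg (hw0 j) (hk0 n j))
    linarith
  have hV0 : 0 ≤ V := Finset.sum_nonneg fun n _ => mul_nonneg (hw0 n) (vecSq_nonneg _)
  calc ∑ n ∈ Finset.range (L + 1), w n * vecSq ((transfer S n).mulVec (v 0)) ≤
      ∑ n ∈ Finset.range (L + 1), (2 * (w n * vecSq (v n)) +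
        2 * (δ * V) * (∑ j ∈ Finset.range (L + 1), w n * w j * k n j)) := by
        refine Finset.sum_le_sum fun n hn => ?_
        have := mul_le_mul_of_nonneg_left (hdiff n hn) (hw0 n)
        refine this.trans (le_of_eq ?_)
        simp only [mul_assoc, ← Finset.mul_sum]
        ring
    _ = 2 * V + 2 * (δ * V) * (2 * gramDet S w (L + 1)) := by
        rw [Finset.sum_add_distrib, ← Finset.mul_sum, ← Finset.mul_sum,
          sum_frobSq_eq_gramDet hS]
    _ ≤ 3 * V := by nlinarith

/-- A solution of a perturbed linear recursion in `ℂ²` cannot be small on the scale at which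
the perturbation becomes effective. -/
theorem vecSq_le_of_perturbed {S : ℕ → Matrix (Fin 2) (Fin 2) ℂ} (hS : ∀ n, ‖(S n).det‖ = 1)
    {v d : ℕ → Fin 2 → ℂ} (hv : ∀ n, v (n + 1) = (S n).mulVec (v n + d n)) {ε B : ℝ}
    (hε : 0 < ε) (hε' : ε ≤ 1 / 6) (hd : ∀ n, vecSq (d n) ≤ 4 * ε ^ 2 * vecSq (v n))
    (hB : ∀ n : ℕ, (n : ℝ) ≤ ε⁻¹ → frobSq (transfer S n) ≤ B) :
    ∃ L : ℕ, vecSq (v 0) ≤ 100 * ε * B * ∑ n ∈ Finset.range (L + 1), vecSq (v n) := by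
  -- With `δ = 4 ε²` this value makes `2 δ K = 1 / 4`; it is at least `1` because `ε ≤ 1 / 6`.
  obtain ⟨L, t, ht0, ht1, hL, hK⟩ := exists_gramDet_eq hS (K := (32 * ε ^ 2)⁻¹) (by
    rw [one_le_inv₀ (by positivity)]; nlinarith)
  refine ⟨L, ?_⟩
  have h1 := sum_unperturbed_le hS hv hd (by positivity) (L := L) ht0 (by
    rw [hK]; apply le_of_eq; field_simp; norm_num)
  have hw0 : ∀ n, 0 ≤ stepWeight L t n := by
    intro n; rw [stepWeight]; split_ifs <;> linarith
  have hw1 : ∀ n, stepWeight L t n ≤ 1 := by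
    intro n; rw [stepWeight]; split_ifs <;> linarith
  set w := stepWeight L t with hw
  set X := ∑ n ∈ Finset.range (L + 1), vecSq (v n) with hX
  have h2 : ∑ n ∈ Finset.range (L + 1), w n * vecSq (v n) ≤ X :=
    Finset.sum_le_sum fun n _ => mul_le_of_le_one_left (vecSq_nonneg _) (hw1 n)
  -- Since `L² ≤ K`, all indices up to `L` lie in the range where `hB` applies.
  have hLε : (L : ℝ) * ε ≤ 1 / 5 := by
    have : ((L : ℝ) * ε) ^ 2 ≤ 1 / 32 := by
      rw [mul_pow]
      calc (L : ℝ) ^ 2 * ε ^ 2 ≤ (32 * ε ^ 2)⁻¹ * ε ^ 2 := by gcongr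
        _ = 1 / 32 := by field_simp
    have h0 : 0 ≤ (L : ℝ) * ε := by positivity
    nlinarith
  have hform : ∑ n ∈ Finset.range (L + 1), w n * vecSq ((transfer S n).mulVec (v 0)) =
      (∑ n ∈ Finset.range (L + 1), w n * colSq (transfer S n) 0) * normSq (v 0 0) +
      (∑ n ∈ Finset.range (L + 1), w n * colSq (transfer S n) 1) * normSq (v 0 1) +
      2 * ((∑ n ∈ Finset.range (L + 1), w n * (colInner (transfer S n)).re) *
          (conj (v 0 0) * v 0 1).re -
        (∑ n ∈ Finset.range (L + 1), w n * (colInner (transfer S n)).im) *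
          (conj (v 0 0) * v 0 1).im) := by
    simp only [Finset.sum_mul, Finset.mul_sum, ← Finset.sum_add_distrib, ← Finset.sum_sub_distrib]
    refine Finset.sum_congr rfl fun n _ => ?_
    rw [vecSq_mulVec]
    ring
  -- The smallest eigenvalue of the Gram matrix is at least determinant over trace; the determinant
  -- is `K` and the trace at most `(L + 1) B`.
  have h3 := det_mul_le_trace_mul_form
    (∑ n ∈ Finset.range (L + 1), w n * colSq (transfer S n) 0)
    (∑ n ∈ Finset.range (L + 1), w n * colSq (transfer S n) 1)
    (∑ n ∈ Finset.range (L + 1), w n * (colInner (transfer S n)).re)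
    (∑ n ∈ Finset.range (L + 1), w n * (colInner (transfer S n)).im) (v 0 0) (v 0 1)
  rw [← hform] at h3
  have hdet := hK
  rw [gramDet] at hdet
  rw [hdet, ← Finset.sum_add_distrib] at h3
  have hB0 : 0 ≤ B := (frobSq_nonneg _).trans (hB 0 (by simpa using hε.le))
  have htr : ∑ n ∈ Finset.range (L + 1),
      (w n * colSq (transfer S n) 0 + w n * colSq (transfer S n) 1) ≤ (L + 1) * B := by
    calc _ ≤ ∑ n ∈ Finset.range (L + 1), B := by
          refine Finset.sum_le_sum fun n hn => ?_
          rw [← mul_add, ← frobSq_eq_colSq]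
          refine (mul_le_of_le_one_left (frobSq_nonneg _) (hw1 n)).trans (hB n ?_)
          have hn' : (n : ℝ) ≤ L := by
            exact_mod_cast Nat.lt_succ_iff.1 (Finset.mem_range.1 hn)
          rw [← one_div, le_div_iff₀ hε]
          nlinarith
      _ = (L + 1) * B := by simp
  have hX0 : 0 ≤ X := Finset.sum_nonneg fun n _ => vecSq_nonneg _
  have h4 : (32 * ε ^ 2)⁻¹ * vecSq (v 0) ≤ (L + 1) * B * (3 * X) := by
    refine h3.trans ?_
    refine mul_le_mul htr (by linarith) ?_ (by positivity)
    exact Finset.sum_nonneg fun n _ => mul_nonneg (hw0 n) (vecSq_nonneg _)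
  rw [inv_mul_le_iff₀ (by positivity)] at h4
  refine h4.trans ?_
  have h5 : ((L : ℝ) + 1) * ε ≤ 2 / 5 := by nlinarith
  calc 32 * ε ^ 2 * ((L + 1) * B * (3 * X)) = 96 * ε * B * X * ((L + 1) * ε) := by ring
    _ ≤ 96 * ε * B * X * (2 / 5) := by gcongr
    _ ≤ 100 * ε * B * X := by
      have : 0 ≤ ε * B * X := by positivity
      linarith

/-! ### Carathéodory functions and resolvents -/

theorem Circle.sub_ne_zero_of_norm_lt {z : ℂ} (hz : ‖z‖ < 1) (w : Circle) : (w : ℂ) - z ≠ 0 := by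
  intro h
  rw [sub_eq_zero] at h
  rw [← h, Circle.norm_coe] at hz
  exact lt_irrefl _ hz

theorem continuous_caratheodory_kernel {z : ℂ} (hz : ‖z‖ < 1) :
    Continuous fun w : Circle => ((w : ℂ) + z) / ((w : ℂ) - z) := by
  refine Continuous.div (by fun_prop) (by fun_prop) (Circle.sub_ne_zero_of_norm_lt hz)

theorem Circle.integrable_of_continuous {E : Type*} [NormedAddCommGroup E] (ν : Measure Circle)
    [IsFiniteMeasure ν] {f : Circle → E} (hf : Continuous f) : Integrable f ν :=
  hf.integrable_of_hasCompactSupport (HasCompactSupport.of_compactSpace _)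

theorem norm_caratheodory_kernel_le {z : ℂ} (hz : ‖z‖ < 1) (w : Circle) :
    ‖((w : ℂ) + z) / ((w : ℂ) - z)‖ ≤ 2 / (1 - ‖z‖) := by
  rw [norm_div]
  have h1 : ‖(w : ℂ) + z‖ ≤ 2 := (norm_add_le _ _).trans (by rw [Circle.norm_coe]; linarith)
  have h2 : 1 - ‖z‖ ≤ ‖(w : ℂ) - z‖ := by
    have := norm_sub_norm_le (w : ℂ) z
    rwa [Circle.norm_coe] at this
  exact div_le_div₀ (by norm_num) h1 (by linarith) h2

theorem norm_caratheodory_le (ν : Measure Circle) [IsProbabilityMeasure ν] {z : ℂ} (hz : ‖z‖ < 1) :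
    ‖caratheodory ν z‖ ≤ 2 / (1 - ‖z‖) := by
  have := norm_integral_le_of_norm_le_const (μ := ν)
    (ae_of_all ν (norm_caratheodory_kernel_le hz))
  simpa [caratheodory] using this

theorem re_caratheodory_kernel (z : ℂ) (w : Circle) :
    (((w : ℂ) + z) / ((w : ℂ) - z)).re = (1 - ‖z‖ ^ 2) / ‖(w : ℂ) - z‖ ^ 2 := by
  have hw : normSq (w : ℂ) = 1 := Circle.normSq_coe w
  rw [div_re, ← normSq_eq_norm_sq, ← normSq_eq_norm_sq, ← add_div]
  congr 1
  rw [← hw]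
  simp only [normSq_apply, add_re, add_im, sub_re, sub_im]
  ring

theorem re_caratheodory (ν : Measure Circle) [IsFiniteMeasure ν] {z : ℂ} (hz : ‖z‖ < 1) :
    (caratheodory ν z).re = ∫ w : Circle, (1 - ‖z‖ ^ 2) / ‖(w : ℂ) - z‖ ^ 2 ∂ν := by
  have h := integral_re (𝕜 := ℂ)
    (Circle.integrable_of_continuous ν (continuous_caratheodory_kernel hz))
  simp only [caratheodory, ← re_caratheodory_kernel]
  exact h.symm

theorem re_caratheodory_nonneg (ν : Measure Circle) [IsFiniteMeasure ν] {z : ℂ} (hz : ‖z‖ < 1) :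
    0 ≤ (caratheodory ν z).re := by
  rw [re_caratheodory ν hz]
  refine integral_nonneg fun w => div_nonneg ?_ (by positivity)
  nlinarith [norm_nonneg z]

theorem norm_one_sub_mul_circle {ε : ℝ} (hε : ε < 1) (w : Circle) :
    ‖((1 - ε : ℂ)) * (w : ℂ)‖ = 1 - ε := by
  have : ((1 - ε : ℂ)) = ((1 - ε : ℝ) : ℂ) := by push_cast; ring
  rw [norm_mul, Circle.norm_coe, mul_one, this, Complex.norm_real, Real.norm_of_nonneg (by linarith)]

/-- The Poisson kernel bounds the measure of an arc by the Carathéodory function. -/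
theorem measure_arc_le (ν : Measure Circle) [IsFiniteMeasure ν] {ζ ε : ℝ} (hε : 0 < ε)
    (hε' : ε < 1) :
    ν (arc (ζ - ε) (ζ + ε)) ≤
      ENNReal.ofReal (4 * ε * (caratheodory ν ((1 - ε) * Circle.exp ζ)).re) := by
  set z : ℂ := (1 - ε) * Circle.exp ζ with hz
  have hzn : ‖z‖ = 1 - ε := norm_one_sub_mul_circle hε' _
  have hz1 : ‖z‖ < 1 := by rw [hzn]; linarith
  set f : Circle → ℝ := fun w => (1 - ‖z‖ ^ 2) / ‖(w : ℂ) - z‖ ^ 2 with hf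
  have hfc : Continuous f := by
    refine Continuous.div (by fun_prop) (by fun_prop) fun w => ?_
    exact pow_ne_zero 2 (norm_ne_zero_iff.2 (Circle.sub_ne_zero_of_norm_lt hz1 w))
  have hf0 : ∀ w, 0 ≤ f w := fun w => div_nonneg (by rw [hzn]; nlinarith) (by positivity)
  set A : Set Circle := {w | (4 * ε)⁻¹ ≤ f w} with hA
  have hsub : arc (ζ - ε) (ζ + ε) ⊆ A := by
    rintro _ ⟨θ, ⟨h1, h2⟩, rfl⟩
    -- Arc points are within `ε` of `exp ζ`, which is within `ε` of `z`. As `1 - |z|² ≥ ε`, the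
    -- Poisson kernel is at least `1 / (4 ε)` on the arc, and Markov's inequality finishes.
    have hd : ‖((Circle.exp θ : Circle) : ℂ) - z‖ ≤ 2 * ε := by
      have e : ((Circle.exp θ : Circle) : ℂ) - z =
          (((Circle.exp θ : Circle) : ℂ) - (Circle.exp ζ : Circle)) + ε * (Circle.exp ζ : Circle) := by
        rw [hz]; ring
      rw [e]
      refine (norm_add_le _ _).trans ?_
      have e1 : ‖((Circle.exp θ : Circle) : ℂ) - (Circle.exp ζ : Circle)‖ ≤ ε := by
        have e2 : ((Circle.exp θ : Circle) : ℂ) - (Circle.exp ζ : Circle) =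
            (Circle.exp ζ : Circle) * (Complex.exp (I * (θ - ζ : ℝ)) - 1) := by
          simp only [Circle.coe_exp]
          rw [mul_sub, ← Complex.exp_add, mul_one]
          congr 2
          push_cast; ring
        rw [e2, norm_mul, Circle.norm_coe, one_mul]
        refine (Real.norm_exp_I_mul_ofReal_sub_one_le).trans ?_
        rw [Real.norm_eq_abs, abs_le]
        constructor <;> linarith
      rw [norm_mul, Circle.norm_coe, mul_one, Complex.norm_real, Real.norm_of_nonneg hε.le]
      linarith
    have hd0 : 0 < ‖((Circle.exp θ : Circle) : ℂ) - z‖ :=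
      norm_pos_iff.2 (Circle.sub_ne_zero_of_norm_lt hz1 _)
    change (4 * ε)⁻¹ ≤ (1 - ‖z‖ ^ 2) / ‖((Circle.exp θ : Circle) : ℂ) - z‖ ^ 2
    rw [hzn, le_div_iff₀ (by positivity), inv_mul_le_iff₀ (by positivity)]
    have : ‖((Circle.exp θ : Circle) : ℂ) - z‖ ^ 2 ≤ (2 * ε) ^ 2 := by gcongr
    nlinarith
  have hmk := mul_meas_ge_le_integral_of_nonneg (ae_of_all ν hf0)
    (Circle.integrable_of_continuous ν hfc) (4 * ε)⁻¹
  rw [inv_mul_le_iff₀ (by positivity)] at hmk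
  refine (measure_mono hsub).trans ?_
  rw [← ofReal_measureReal]
  refine ENNReal.ofReal_le_ofReal ?_
  rw [re_caratheodory ν hz1]
  exact hmk

/-! ### Spectral measures and resolvents of a unitary operator. -/

section Resolvent

variable {H : Type*} [NormedAddCommGroup H] [InnerProductSpace ℂ H] [CompleteSpace H]

theorem isProbabilityMeasure_spectralMeasure (U : H ≃ₗᵢ[ℂ] H) {ψ : H} (hψ : ‖ψ‖ = 1) :
    IsProbabilityMeasure (spectralMeasure U ψ) := by
  have h := integral_zpow_spectralMeasure U ψ 0
  simp only [zpow_zero, Circle.coe_one, integral_const,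
    LinearIsometryEquiv.coe_one, id_eq, inner_self_eq_norm_sq_to_K, hψ] at h
  constructor
  have h2 : (spectralMeasure U ψ).real univ = 1 := by
    simpa using congrArg Complex.re h
  rw [← ofReal_measureReal, h2, ENNReal.ofReal_one]

/-- The vector `u` is `(U - z)⁻¹ ψ`, given by the Neumann series `∑ zᵏ U⁻ᵏ⁻¹ ψ`, whose coefficients
against `ψ` are moments of the spectral measure. -/
theorem caratheodory_spectralMeasure (U : H ≃ₗᵢ[ℂ] H) {ψ : H} (hψ : ‖ψ‖ = 1) {z : ℂ}
    (hz : ‖z‖ < 1) :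
    ∃ u : H, U u = z • u + ψ ∧ caratheodory (spectralMeasure U ψ) z = 1 + 2 * z * ⟪ψ, u⟫_ℂ := by
  have hprob := isProbabilityMeasure_spectralMeasure U hψ
  set f : ℕ → H := fun k => z ^ k • (U ^ (-((k : ℤ) + 1))) ψ with hf
  have hfn : ∀ k, ‖f k‖ = ‖z‖ ^ k := by
    intro k
    rw [hf]
    simp only [norm_smul, norm_pow, LinearIsometryEquiv.norm_map, hψ, mul_one]
  have hgeom := summable_geometric_of_lt_one (norm_nonneg z) hz
  have hsum : Summable f := Summable.of_norm (by simpa only [hfn] using hgeom)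
  have hU0 : U (f 0) = ψ := by
    simp [hf]
  have hU1 : ∀ k, U (f (k + 1)) = z • f k := by
    intro k
    have : U * U ^ (-(((k + 1 : ℕ) : ℤ) + 1)) = U ^ (-((k : ℤ) + 1)) := by
      rw [mul_self_zpow]; congr 1
    have h2 := congrArg (fun V : H ≃ₗᵢ[ℂ] H => V ψ) this
    simp only [LinearIsometryEquiv.coe_mul, Function.comp_apply] at h2
    simp only [hf]
    rw [map_smul, h2, pow_succ', mul_smul]
  refine ⟨∑' k, f k, ?_, ?_⟩
  · have h1 : U (∑' k, f k) = ∑' k, U (f k) :=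
      (U : H ≃L[ℂ] H).map_tsum
    have hsU : Summable fun k => U (f k) := (U : H ≃L[ℂ] H).summable.2 hsum
    rw [h1, hsU.tsum_eq_zero_add, hU0]
    simp only [hU1]
    rw [hsum.tsum_const_smul z, add_comm]
  · have h1 : ⟪ψ, ∑' k, f k⟫_ℂ = ∑' k, ⟪ψ, f k⟫_ℂ := (innerSL ℂ ψ).map_tsum hsum
    have h2 : ∀ k, ⟪ψ, f k⟫_ℂ =
        ∫ w : Circle, z ^ k * ((w ^ (-((k : ℤ) + 1)) : Circle) : ℂ) ∂(spectralMeasure U ψ) := by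
      intro k
      rw [integral_const_mul, integral_zpow_spectralMeasure, inner_smul_right]
    have h3 := hasSum_integral_of_summable_integral_norm (μ := spectralMeasure U ψ)
      (F := fun (k : ℕ) (w : Circle) => z ^ k * ((w ^ (-((k : ℤ) + 1)) : Circle) : ℂ))
      (fun k => Circle.integrable_of_continuous _
        (continuous_const.mul ((by fun_prop : Continuous fun w : Circle => (w : ℂ)).comp (continuous_zpow _))))
      (by simpa only [norm_mul, norm_pow, Circle.norm_coe, mul_one, integral_const,
        probReal_univ, one_smul] using hgeom)
    have h4 : ∀ w : Circle, ∑' k : ℕ, z ^ k * ((w ^ (-((k : ℤ) + 1)) : Circle) : ℂ) =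
        1 / ((w : ℂ) - z) := by
      intro w
      have hw : (w : ℂ) ≠ 0 := Circle.coe_ne_zero w
      have e : ∀ k : ℕ, z ^ k * ((w ^ (-((k : ℤ) + 1)) : Circle) : ℂ) =
          (w : ℂ)⁻¹ * (z / w) ^ k := by
        intro k
        rw [Circle.coe_zpow, zpow_neg, zpow_add_one₀ hw, zpow_natCast, div_pow]
        field_simp
      simp only [e]
      rw [tsum_mul_left, tsum_geometric_of_norm_lt_one (by rwa [norm_div, Circle.norm_coe, div_one])]
      have := Circle.sub_ne_zero_of_norm_lt hz w
      have h' : 1 - z / (w : ℂ) ≠ 0 := by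
        intro h
        apply this
        field_simp at h
        simpa using h
      field_simp
    simp only [h4] at h3
    have h5 : caratheodory (spectralMeasure U ψ) z =
        ∫ w : Circle, (1 + 2 * z * (1 / ((w : ℂ) - z))) ∂(spectralMeasure U ψ) := by
      rw [caratheodory]
      congr 1
      ext w
      have := Circle.sub_ne_zero_of_norm_lt hz w
      field_simp
      ring
    rw [h5, integral_add (integrable_const _) ?_, integral_const_mul, integral_const,
      probReal_univ, one_smul, ← h3.tsum_eq, h1]
    · simp only [h2]
    · refine (Circle.integrable_of_continuous _ ?_)
      exact continuous_const.mul (Continuous.div continuous_const (by fun_prop)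
        (Circle.sub_ne_zero_of_norm_lt hz))

end Resolvent

section

variable {H : Type*} [NormedAddCommGroup H] [InnerProductSpace ℂ H]

/-- Expand `‖z u + ψ‖² = ‖U u‖² = ‖u‖²`. This is the energy identity `ε ‖u‖² ≲ Re F`. -/
theorem resolvent_norm_sq {U : H ≃ₗᵢ[ℂ] H} {ψ u : H} (hψ : ‖ψ‖ = 1) {z : ℂ}
    (hu : U u = z • u + ψ) :
    (1 - ‖z‖ ^ 2) * ‖u‖ ^ 2 = (1 + 2 * z * ⟪ψ, u⟫_ℂ).re := by
  have h : ‖U u‖ ^ 2 = ‖u‖ ^ 2 := by rw [U.norm_map]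
  rw [hu, @norm_add_sq ℂ, norm_smul, hψ, inner_smul_left, ← inner_conj_symm u ψ, ← map_mul] at h
  simp only [RCLike.re_to_complex, conj_re] at h
  have e : (1 + 2 * z * ⟪ψ, u⟫_ℂ).re = 1 + 2 * (z * ⟪ψ, u⟫_ℂ).re := by
    rw [mul_assoc]; simp
  rw [e]
  linarith

/-- Allows additive constants to be absorbed into `‖u‖²`. -/
theorem one_le_two_mul_norm_resolvent {U : H ≃ₗᵢ[ℂ] H} {ψ u : H} (hψ : ‖ψ‖ = 1) {z : ℂ}
    (hz : ‖z‖ < 1) (hu : U u = z • u + ψ) : 1 ≤ 2 * ‖u‖ := by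
  have h : ψ = U u - z • u := by rw [hu]; abel
  have h2 : ‖ψ‖ ≤ ‖u‖ + ‖z‖ * ‖u‖ := by
    conv_lhs => rw [h]
    refine (norm_sub_le _ _).trans (le_of_eq ?_)
    rw [U.norm_map, norm_smul]
  rw [hψ] at h2
  nlinarith [norm_nonneg u]

end

/-! ### Szegő recursion at an interior point -/

theorem rho_pos (α : 𝔻) : 0 < rho α :=
  Real.sqrt_pos.2 (by linarith [α.sq_norm_lt_one])

theorem rho_ne_zero (α : 𝔻) : (rho α : ℂ) ≠ 0 := by
  exact_mod_cast (rho_pos α).ne'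

theorem norm_circle_cpow (z : Circle) (s : ℝ) : ‖(z : ℂ) ^ (s : ℂ)‖ = 1 := by
  rw [Complex.norm_cpow_of_ne_zero (Circle.coe_ne_zero z), Circle.norm_coe]
  simp

theorem cpow_neg_half_sq_mul (z : Circle) : ((z : ℂ) ^ (-(1 / 2) : ℂ)) ^ 2 * z = 1 := by
  have hz := Circle.coe_ne_zero z
  rw [← Complex.cpow_nat_mul]
  have : ((2 : ℕ) : ℂ) * -(1 / 2) = -1 := by norm_num
  rw [this, Complex.cpow_neg_one, inv_mul_cancel₀ hz]

theorem norm_cpow_neg_half (z : Circle) : ‖(z : ℂ) ^ (-(1 / 2) : ℂ)‖ = 1 := by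
  have h := norm_circle_cpow z (-(1 / 2))
  push_cast at h
  exact h

theorem norm_det_szegoMatrix (α : 𝔻) (z : Circle) : ‖(szegoMatrix α z).det‖ = 1 := by
  have h : (szegoMatrix α z).det = 1 := by
    have h1 := conj_mul_add_rho_sq α
    have h2 := cpow_neg_half_sq_mul z
    have h3 := rho_ne_zero α
    rw [szegoMatrix, Matrix.det_smul, Matrix.det_fin_two_of, Fintype.card_fin]
    push_cast
    calc _ = (((z : ℂ) ^ (-(1 / 2) : ℂ)) ^ 2 * z) * ((1 - conj (α : ℂ) * α) / (rho α : ℂ) ^ 2) := by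
          ring
      _ = 1 := by
          rw [h2, ← h1]
          field_simp
          ring
  rw [h, norm_one]

theorem szegoMatrix_mulVec (α : 𝔻) (z : ℂ) (v : Fin 2 → ℂ) :
    (szegoMatrix α z).mulVec v =
      ![z ^ (-(1 / 2) : ℂ) * ((rho α)⁻¹ : ℝ) * (z * v 0 - conj (α : ℂ) * v 1),
        z ^ (-(1 / 2) : ℂ) * ((rho α)⁻¹ : ℝ) * (v 1 - α * z * v 0)] := by
  ext i
  fin_cases i <;>
    simp [szegoMatrix, Matrix.mulVec, dotProduct, Fin.sum_univ_two] <;> ring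

/-- The square root of `1 / (r z₀)` that is used in the normalization of the Szegő matrices. -/
noncomputable def invSqrt (z₀ : Circle) (r : ℝ) : ℂ := (z₀ : ℂ) ^ (-(1 / 2) : ℂ) * ((√r : ℝ) : ℂ)⁻¹

theorem invSqrt_sq_mul (z₀ : Circle) {r : ℝ} (hr : 0 < r) :
    invSqrt z₀ r ^ 2 * (r * z₀) = 1 := by
  have h := cpow_neg_half_sq_mul z₀
  have h2 : ((√r : ℝ) : ℂ) ^ 2 = r := by
    rw [← Complex.ofReal_pow, Real.sq_sqrt hr.le]
  have h3 : (r : ℂ) ≠ 0 := by exact_mod_cast hr.ne'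
  rw [invSqrt, mul_pow, inv_pow, h2]
  field_simp
  linear_combination h

theorem normSq_invSqrt (z₀ : Circle) {r : ℝ} (hr : 0 < r) : normSq (invSqrt z₀ r) = r⁻¹ := by
  rw [invSqrt, normSq_mul, normSq_eq_norm_sq, norm_cpow_neg_half, normSq_inv, normSq_ofReal,
    Real.mul_self_sqrt hr.le]
  norm_num

/-- Solutions of the normalized Szegő recursion at the point `r z₀`. -/
def IsSzegoSolution (α : ℕ → 𝔻) (z₀ : Circle) (r : ℝ) (x : ℕ → Fin 2 → ℂ) : Prop :=
  ∀ n, rho (α n) * x (n + 1) 0 =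
      invSqrt z₀ r * (r * z₀ * x n 0 - conj (α n : ℂ) * x n 1) ∧
    rho (α n) * x (n + 1) 1 = invSqrt z₀ r * (x n 1 - α n * (r * z₀) * x n 0)

/-- With `t = √(1 - ε)`, the normalized matrix at `(1 - ε) z₀` is the one at `z₀` times `diag(t,
t⁻¹)`, and both entries differ from `1` by at most `2 ε`. -/
theorem vecSq_le_of_isSzegoSolution {α : ℕ → 𝔻} {z₀ : Circle} {ε B : ℝ} (hε : 0 < ε)
    (hε' : ε ≤ 1 / 6) {x : ℕ → Fin 2 → ℂ} (hx : IsSzegoSolution α z₀ (1 - ε) x)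
    (hB : ∀ n : ℕ, (n : ℝ) ≤ ε⁻¹ → frobSq (transfer (fun k => szegoMatrix (α k) z₀) n) ≤ B) :
    ∃ L : ℕ, vecSq (x 0) ≤ 100 * ε * B * ∑ n ∈ Finset.range (L + 1), vecSq (x n) := by
  set r := 1 - ε with hr
  set t := √r with ht
  have hr0 : 0 < r := by rw [hr]; linarith
  have ht0 : 0 < t := Real.sqrt_pos.2 hr0
  have htt : t ^ 2 = r := Real.sq_sqrt hr0.le
  have ht1 : t ≤ 1 := by nlinarith
  have hlow : 1 - ε ≤ t := by nlinarith
  have htc : (t : ℂ) ≠ 0 := by exact_mod_cast ht0.ne'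
  have httc : (t : ℂ) ^ 2 = r := by exact_mod_cast htt
  refine vecSq_le_of_perturbed (S := fun k => szegoMatrix (α k) z₀)
    (fun n => norm_det_szegoMatrix _ _)
    (d := fun n => ![((t - 1 : ℝ) : ℂ) * x n 0, ((t⁻¹ - 1 : ℝ) : ℂ) * x n 1]) ?_ hε hε' ?_ hB
  · intro n
    have hρ := rho_ne_zero (α n)
    obtain ⟨h0, h1⟩ := hx n
    rw [invSqrt, ← ht] at h0 h1
    rw [szegoMatrix_mulVec]
    ext i
    fin_cases i
    · simp only [Pi.add_apply, Matrix.cons_val_zero, Matrix.cons_val_one, Fin.zero_eta]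
      push_cast
      rw [← mul_right_inj' hρ, h0, ← httc]
      field_simp
      ring
    · simp only [Pi.add_apply, Matrix.cons_val_zero, Matrix.cons_val_one, Fin.mk_one]
      push_cast
      rw [← mul_right_inj' hρ, h1, ← httc]
      field_simp
      ring
  · intro n
    simp only [vecSq, Matrix.cons_val_zero, Matrix.cons_val_one, normSq_mul, normSq_ofReal]
    have e1 : (t - 1) * (t - 1) ≤ 4 * ε ^ 2 := by nlinarith
    have e2 : (t⁻¹ - 1) * (t⁻¹ - 1) ≤ 4 * ε ^ 2 := by
      have h1 : t⁻¹ - 1 ≤ 2 * ε := by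
        have : t⁻¹ ≤ 1 + 2 * ε := by
          rw [inv_le_comm₀ ht0 (by linarith), inv_le_iff_one_le_mul₀ (by linarith)]
          nlinarith
        linarith
      have h0 : 0 ≤ t⁻¹ - 1 := by
        have := (one_le_inv₀ ht0).2 ht1
        linarith
      nlinarith
    have p0 := normSq_nonneg (x n 0)
    have p1 := normSq_nonneg (x n 1)
    nlinarith [mul_le_mul_of_nonneg_right e1 p0, mul_le_mul_of_nonneg_right e2 p1]

/-! ### Resolvents of CMV matrices -/

/-- The solution of the Szegő recursion formed from `u` and `v = 𝓜 u`. -/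
noncomputable def cmvVec (z₀ : Circle) (r : ℝ) (u v : ℕ → ℂ) (n : ℕ) : Fin 2 → ℂ :=
  if Even n then ![u n, v n] else ![invSqrt z₀ r * v n, invSqrt z₀ r * (r * z₀) * u n]

/-- A block `Θₙ` relates the entries at `n` and `n + 1`; solved for those at `n + 1` it is one Szegő
step. The roles of `u` and `v` alternate with parity, and the factors match because `invSqrt z₀ r ^
2 * (r * z₀) = 1`. -/
theorem isSzegoSolution_cmvVec {α : ℕ → 𝔻} {z₀ : Circle} {r : ℝ} (hr : 0 < r) {u v : ℕ → ℂ}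
    {k : ℕ}
    (heven : ∀ n, k ≤ n → Even n → (r : ℂ) * z₀ * u n = conj (α n : ℂ) * v n + rho (α n) * v (n + 1) ∧
      (r : ℂ) * z₀ * u (n + 1) = rho (α n) * v n - α n * v (n + 1))
    (hodd : ∀ n, k ≤ n → ¬ Even n → v n = conj (α n : ℂ) * u n + rho (α n) * u (n + 1) ∧
      v (n + 1) = rho (α n) * u n - α n * u (n + 1)) :
    IsSzegoSolution (fun n => α (k + n)) z₀ r (fun n => cmvVec z₀ r u v (k + n)) := by
  intro m
  have hkm : k ≤ k + m := Nat.le_add_right _ _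
  simp only [← add_assoc]
  generalize k + m = n at hkm ⊢
  have hρ := conj_mul_add_rho_sq (α n)
  have hτ := invSqrt_sq_mul z₀ hr
  by_cases h : Even n
  · obtain ⟨h1, h2⟩ := heven n hkm h
    have h' : ¬ Even (n + 1) := by rw [Nat.even_add_one]; exact not_not.2 h
    simp only [cmvVec, if_pos h, if_neg h', Matrix.cons_val_zero, Matrix.cons_val_one]
    constructor
    · linear_combination -invSqrt z₀ r * h1
    · linear_combination invSqrt z₀ r * (rho (α n) * h2 + α n * h1 + v n * hρ)
  · obtain ⟨h1, h2⟩ := hodd n hkm h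
    have h' : Even (n + 1) := by rw [Nat.even_add_one]; exact h
    simp only [cmvVec, if_pos h', if_neg h, Matrix.cons_val_zero, Matrix.cons_val_one]
    constructor
    · linear_combination -h1 - (v n - conj (α n : ℂ) * u n) * hτ
    · linear_combination rho (α n) * h2 + α n * h1 + u n * hρ - (u n - α n * v n) * hτ

theorem vecSq_cmvVec_le (z₀ : Circle) {r : ℝ} (hr : 1 / 2 ≤ r) (hr' : r ≤ 1) (u v : ℕ → ℂ) (n : ℕ) :
    vecSq (cmvVec z₀ r u v n) ≤ 2 * (normSq (u n) + normSq (v n)) := by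
  have hu := normSq_nonneg (u n)
  have hv := normSq_nonneg (v n)
  unfold cmvVec
  split_ifs
  · simp only [vecSq, Matrix.cons_val_zero, Matrix.cons_val_one]
    linarith
  · simp only [vecSq, Matrix.cons_val_zero, Matrix.cons_val_one, normSq_mul,
      normSq_invSqrt z₀ (by linarith : 0 < r), Circle.normSq_coe, normSq_ofReal]
    have e1 : r⁻¹ ≤ 2 := by
      rw [inv_le_comm₀ (by linarith) (by norm_num)]; linarith
    have e2 : r⁻¹ * (r * r * 1) = r := by field_simp
    rw [e2]
    nlinarith

/-- The closing argument for resolvents, with `W` standing for `‖u‖²`: the start is at most of order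
`ε B W ≤ B ‖F‖`, while `‖F‖²` is controlled by the start. -/
theorem norm_le_of_cmv {α : ℕ → 𝔻} {z₀ : Circle} {ε B : ℝ} (hε : 0 < ε) (hε' : ε ≤ 1 / 6)
    {u v : ℕ → ℂ} {k : ℕ}
    (heven : ∀ n, k ≤ n → Even n →
      ((1 - ε : ℝ) : ℂ) * z₀ * u n = conj (α n : ℂ) * v n + rho (α n) * v (n + 1) ∧
      ((1 - ε : ℝ) : ℂ) * z₀ * u (n + 1) = rho (α n) * v n - α n * v (n + 1))
    (hodd : ∀ n, k ≤ n → ¬ Even n → v n = conj (α n : ℂ) * u n + rho (α n) * u (n + 1) ∧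
      v (n + 1) = rho (α n) * u n - α n * u (n + 1))
    (hB : ∀ n : ℕ, (n : ℝ) ≤ ε⁻¹ →
      frobSq (transfer (fun j => szegoMatrix (α (k + j)) z₀) n) ≤ B) (hB1 : 1 ≤ B)
    {F : ℂ} {W : ℝ} (hF : ε * W ≤ ‖F‖)
    (hW : ∀ N, ∑ n ∈ Finset.range N, (normSq (u (k + n)) + normSq (v (k + n))) ≤ 15 * W)
    (hstart : ‖F‖ ≤ 1 + 2 * √(vecSq (cmvVec z₀ (1 - ε) u v k))) :
    ‖F‖ ≤ 48000 * B := by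
  obtain ⟨L, hL⟩ := vecSq_le_of_isSzegoSolution hε hε'
    (isSzegoSolution_cmvVec (by linarith : 0 < 1 - ε) heven hodd) hB
  simp only [add_zero] at hL
  have h1 : ∑ n ∈ Finset.range (L + 1), vecSq (cmvVec z₀ (1 - ε) u v (k + n)) ≤ 30 * W := by
    calc _ ≤ ∑ n ∈ Finset.range (L + 1), 2 * (normSq (u (k + n)) + normSq (v (k + n))) :=
          Finset.sum_le_sum fun n _ => vecSq_cmvVec_le z₀ (by linarith) (by linarith) u v _
      _ ≤ 30 * W := by rw [← Finset.mul_sum]; linarith [hW (L + 1)]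
  have h2 : vecSq (cmvVec z₀ (1 - ε) u v k) ≤ 3000 * B * ‖F‖ := by
    calc _ ≤ 100 * ε * B * (30 * W) := hL.trans (by gcongr)
      _ = 3000 * B * (ε * W) := by ring
      _ ≤ 3000 * B * ‖F‖ := by gcongr
  -- Small `F` is covered by `1 ≤ B`; otherwise the summand `1` in `hstart` is absorbed into `‖F‖ /
  -- 2`.
  by_cases hF2 : ‖F‖ ≤ 2
  · linarith
  push Not at hF2
  have h3 : √(vecSq (cmvVec z₀ (1 - ε) u v k)) ^ 2 = vecSq (cmvVec z₀ (1 - ε) u v k) :=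
    Real.sq_sqrt (vecSq_nonneg _)
  have h4 : ‖F‖ ≤ 4 * √(vecSq (cmvVec z₀ (1 - ε) u v k)) := by linarith
  have h5 : ‖F‖ ^ 2 ≤ 16 * (3000 * B * ‖F‖) := by
    calc ‖F‖ ^ 2 ≤ (4 * √(vecSq (cmvVec z₀ (1 - ε) u v k))) ^ 2 := by gcongr
      _ ≤ _ := by rw [mul_pow, h3]; linarith
  nlinarith

theorem sum_normSq_comp_le {ι : Type*} (f : ℓ²(ι, ℂ)) {e : ℕ → ι} (he : Function.Injective e)
    (N : ℕ) : ∑ n ∈ Finset.range N, normSq (f (e n)) ≤ ‖f‖ ^ 2 := by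
  have h := lp.sum_rpow_le_norm_rpow (p := 2) (by norm_num) f
    ((Finset.range N).map ⟨e, he⟩)
  simpa [normSq_eq_norm_sq] using h

/-- The solution of the recursion starts at the pair of coordinates carrying `δ₀`. -/
theorem norm_le_of_resolvent_zero {ι : Type*} {e : ℕ → ι} (he : Function.Injective e)
    {α : ℕ → 𝔻} {z₀ : Circle} {ε B : ℝ} (hε : 0 < ε) (hε' : ε ≤ 1 / 6) {u v : ℓ²(ι, ℂ)}
    (hv : ‖v‖ = ‖u‖) (hu : 1 ≤ 2 * ‖u‖)
    (heven : ∀ n, Even n →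
      ((1 - ε : ℝ) : ℂ) * z₀ * u (e n) + (if n = 0 then 1 else 0) =
        conj (α n : ℂ) * v (e n) + rho (α n) * v (e (n + 1)) ∧
      ((1 - ε : ℝ) : ℂ) * z₀ * u (e (n + 1)) = rho (α n) * v (e n) - α n * v (e (n + 1)))
    (hodd : ∀ n, ¬ Even n →
      v (e n) = conj (α n : ℂ) * u (e n) + rho (α n) * u (e (n + 1)) ∧
      v (e (n + 1)) = rho (α n) * u (e n) - α n * u (e (n + 1)))
    (hB : ∀ n : ℕ, (n : ℝ) ≤ ε⁻¹ →
      frobSq (transfer (fun j => szegoMatrix (α j) z₀) n) ≤ B) (hB1 : 1 ≤ B)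
    {F : ℂ} (hF : F = 1 + 2 * (((1 - ε : ℝ) : ℂ) * z₀) * u (e 0))
    (hF2 : (1 - (1 - ε) ^ 2) * ‖u‖ ^ 2 = F.re) :
    ‖F‖ ≤ 48000 * B := by
  set r := 1 - ε with hr
  have hr0 : 0 < r := by linarith
  set z : ℂ := (r : ℂ) * z₀ with hz
  have hz0 : z ≠ 0 := mul_ne_zero (by exact_mod_cast hr0.ne') (Circle.coe_ne_zero z₀)
  have hzn : normSq z = r ^ 2 := by
    rw [hz, normSq_mul, normSq_ofReal, Circle.normSq_coe]; ring
  -- Adding `z⁻¹` at index `0` absorbs the source `δ₀`; the odd blocks on the indices `n ≥ 1` do not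
  -- see this entry. Then `F + 1 = 2 z u' 0`.
  let u' : ℕ → ℂ := fun n => u (e n) + if n = 0 then z⁻¹ else 0
  have hFre : 0 ≤ F.re := by
    rw [← hF2]
    have : 0 ≤ 1 - r ^ 2 := by nlinarith
    positivity
  refine norm_le_of_cmv (u := u') (v := fun n => v (e n)) (k := 0) (α := α) (z₀ := z₀)
    (W := ‖u‖ ^ 2) hε hε' ?_ ?_ (by simpa using hB) hB1 ?_ ?_ ?_
  · intro n _ hn
    have := heven n hn
    refine ⟨?_, ?_⟩
    · rw [← this.1]
      change z * u' n = _
      by_cases h0 : n = 0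
      · simp only [u', h0, if_true]
        rw [mul_add, mul_inv_cancel₀ hz0]
      · simp only [u', h0, if_false, add_zero]
    · rw [← this.2]
      change z * u' (n + 1) = _
      simp [u']
  · intro n _ hn
    have h0 : n ≠ 0 := by rintro rfl; simp at hn
    simpa [u', h0] using hodd n hn
  · have : ε * ‖u‖ ^ 2 ≤ F.re := by
      rw [← hF2]
      have : ε ≤ 1 - r ^ 2 := by rw [hr]; nlinarith
      gcongr
    exact this.trans (re_le_norm F)
  · intro N
    simp only [zero_add, Finset.sum_add_distrib]
    have h1 := sum_normSq_comp_le v he N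
    have h2 := sum_normSq_comp_le u he N
    rw [hv] at h1
    -- The correction costs `‖u‖² + 3`, and `3 ≤ 12 ‖u‖²` by `hu`, which gives the constant `15`.
    have h3 : ∑ n ∈ Finset.range N, normSq (u' n) ≤
        ∑ n ∈ Finset.range N, normSq (u (e n)) + (‖u‖ ^ 2 + 3) := by
      have h4 : ∀ n, normSq (u' n) ≤ normSq (u (e n)) + if n = 0 then ‖u‖ ^ 2 + 3 else 0 := by
        intro n
        by_cases h0 : n = 0
        · simp only [u', h0, if_true]
          have h5 := normSq_add_le (u (e 0)) z⁻¹
          have h6 := sum_normSq_comp_le u he 1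
          simp only [Finset.range_one, Finset.sum_singleton] at h6
          have h7 : normSq z⁻¹ ≤ 3 / 2 := by
            rw [normSq_inv, hzn, inv_le_comm₀ (by positivity) (by norm_num)]
            nlinarith
          linarith
        · simp [u', h0]
      refine (Finset.sum_le_sum fun n _ => h4 n).trans ?_
      rw [Finset.sum_add_distrib, Finset.sum_ite_eq']
      have : 0 ≤ ‖u‖ ^ 2 + 3 := by positivity
      split_ifs <;> linarith
    nlinarith
  · have h1 : F + 1 = 2 * (z * u' 0) := by
      simp only [u', if_true]
      rw [mul_add, mul_inv_cancel₀ hz0, hF]; ring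
    have h2 : ‖F‖ ≤ ‖F + 1‖ := by
      rw [← sq_le_sq₀ (norm_nonneg _) (norm_nonneg _), ← normSq_eq_norm_sq, ← normSq_eq_norm_sq]
      simp only [normSq_apply, add_re, add_im, one_re, one_im]
      nlinarith
    have h3 : ‖z * u' 0‖ ≤ ‖u' 0‖ := by
      have : ‖z‖ ≤ 1 := by
        rw [← sq_le_sq₀ (norm_nonneg _) zero_le_one, ← normSq_eq_norm_sq, hzn]; nlinarith
      rw [norm_mul]
      exact mul_le_of_le_one_left (norm_nonneg _) this
    have h4 : ‖u' 0‖ ≤ √(vecSq (cmvVec z₀ r u' (fun n => v (e n)) 0)) := by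
      refine Real.le_sqrt_of_sq_le ?_
      simp only [cmvVec, Even.zero, if_true, vecSq, Matrix.cons_val_zero, Matrix.cons_val_one]
      rw [← normSq_eq_norm_sq]
      linarith [normSq_nonneg (v (e 0))]
    rw [h1, norm_mul, Complex.norm_two] at h2
    linarith

/-- The solution of the recursion starts to the right of the pair of coordinates carrying `δ₁`. -/
theorem norm_le_of_resolvent_one {ι : Type*} {e : ℕ → ι} (he : Function.Injective e)
    {α : ℕ → 𝔻} {z₀ : Circle} {ε B : ℝ} (hε : 0 < ε) (hε' : ε ≤ 1 / 6) {u v : ℓ²(ι, ℂ)}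
    (hv : ‖v‖ = ‖u‖)
    (heven : ∀ n, 1 ≤ n → Even n →
      ((1 - ε : ℝ) : ℂ) * z₀ * u (e n) =
        conj (α n : ℂ) * v (e n) + rho (α n) * v (e (n + 1)) ∧
      ((1 - ε : ℝ) : ℂ) * z₀ * u (e (n + 1)) = rho (α n) * v (e n) - α n * v (e (n + 1)))
    (hodd : ∀ n, 1 ≤ n → ¬ Even n →
      v (e n) = conj (α n : ℂ) * u (e n) + rho (α n) * u (e (n + 1)) ∧
      v (e (n + 1)) = rho (α n) * u (e n) - α n * u (e (n + 1)))
    (hB : ∀ n : ℕ, (n : ℝ) ≤ ε⁻¹ →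
      frobSq (transfer (fun j => szegoMatrix (α (1 + j)) z₀) n) ≤ B) (hB1 : 1 ≤ B)
    {F : ℂ} (hF : F = 1 + 2 * (((1 - ε : ℝ) : ℂ) * z₀) * u (e 1))
    (hF2 : (1 - (1 - ε) ^ 2) * ‖u‖ ^ 2 = F.re) :
    ‖F‖ ≤ 48000 * B := by
  have hr0 : 0 < 1 - ε := by linarith
  refine norm_le_of_cmv (u := fun n => u (e n)) (v := fun n => v (e n)) (k := 1) (α := α)
    (z₀ := z₀) (W := ‖u‖ ^ 2) hε hε' heven hodd hB hB1 ?_ ?_ ?_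
  · have : ε * ‖u‖ ^ 2 ≤ F.re := by
      rw [← hF2]
      have : ε ≤ 1 - (1 - ε) ^ 2 := by nlinarith
      gcongr
    exact this.trans (re_le_norm F)
  · intro N
    rw [Finset.sum_add_distrib]
    have hinj : Function.Injective fun n => e (1 + n) :=
      he.comp (add_right_injective 1)
    have h1 := sum_normSq_comp_le v hinj N
    have h2 := sum_normSq_comp_le u hinj N
    rw [hv] at h1
    nlinarith [sq_nonneg ‖u‖]
  · set z : ℂ := ((1 - ε : ℝ) : ℂ) * z₀ with hz
    have hzn : normSq z = (1 - ε) ^ 2 := by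
      rw [hz, normSq_mul, normSq_ofReal, Circle.normSq_coe]; ring
    -- At the odd index `1` the second entry is `invSqrt z₀ (1 - ε) * z * u (e 1)`, and the first
    -- factor has modulus at least one.
    have h1 : ‖z * u (e 1)‖ ≤ √(vecSq (cmvVec z₀ (1 - ε) (fun n => u (e n)) (fun n => v (e n)) 1)) := by
      refine Real.le_sqrt_of_sq_le ?_
      simp only [cmvVec, Nat.not_even_one, if_false, vecSq, Matrix.cons_val_zero,
        Matrix.cons_val_one]
      rw [← normSq_eq_norm_sq, normSq_mul, normSq_mul (invSqrt z₀ (1 - ε) * _), ← hz, normSq_mul _ z,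
        hzn, normSq_invSqrt z₀ hr0]
      have h2 := normSq_nonneg (invSqrt z₀ (1 - ε) * v (e 1))
      have h3 : (1 - ε)⁻¹ * (1 - ε) ^ 2 = 1 - ε := by field_simp
      rw [h3]
      have h4 : (1 - ε) ^ 2 * normSq (u (e 1)) ≤ (1 - ε) * normSq (u (e 1)) :=
        mul_le_mul_of_nonneg_right (by nlinarith) (normSq_nonneg _)
      linarith
    calc ‖F‖ = ‖1 + 2 * (z * u (e 1))‖ := by rw [hF, mul_assoc]
      _ ≤ 1 + 2 * ‖z * u (e 1)‖ := by
        refine (norm_add_le _ _).trans ?_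
        rw [norm_one, norm_mul 2, Complex.norm_two]
      _ ≤ _ := by linarith

/-! ### Weyl solutions of orthogonal polynomials on the unit circle -/

/-- On the circle the Szegő step preserves the form `|x₁|² - |x₀|²`. At radius `r = 1 - ε` its two
terms are first multiplied by `r⁻¹ ≥ 1 + ε` and `r`, so the form gains at least `ε |x|²`. -/
theorem isSzegoSolution_step {α : ℕ → 𝔻} {z₀ : Circle} {ε : ℝ} (hε : 0 < ε) (hε' : ε < 1)
    {x : ℕ → Fin 2 → ℂ} (hx : IsSzegoSolution α z₀ (1 - ε) x) (n : ℕ) :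
    normSq (x n 1) - normSq (x n 0) + ε * vecSq (x n) ≤
      normSq (x (n + 1) 1) - normSq (x (n + 1) 0) := by
  set r := 1 - ε with hr
  have hr0 : 0 < r := by linarith
  obtain ⟨h0, h1⟩ := hx n
  have e0 := congrArg normSq h0
  have e1 := congrArg normSq h1
  rw [normSq_mul, normSq_mul (invSqrt z₀ r), normSq_invSqrt z₀ hr0, normSq_ofReal] at e0 e1
  have hρ : rho (α n) * rho (α n) = 1 - normSq (α n : ℂ) := by
    rw [rho, Real.mul_self_sqrt (by linarith [(α n).sq_norm_lt_one]), normSq_eq_norm_sq]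
  have hz : normSq ((r : ℂ) * z₀ * x n 0) = r ^ 2 * normSq (x n 0) := by
    rw [normSq_mul, normSq_mul, normSq_ofReal, Circle.normSq_coe]; ring
  have key : ∀ a y b : ℂ, normSq (b - a * y) - normSq (y - conj a * b) =
      (1 - normSq a) * (normSq b - normSq y) := by
    intro a y b
    simp only [normSq_apply, sub_re, sub_im, mul_re, mul_im, conj_re, conj_im]
    ring
  have k := key (α n) ((r : ℂ) * z₀ * x n 0) (x n 1)
  have hρ0 : 0 < rho (α n) * rho (α n) := mul_pos (rho_pos _) (rho_pos _)
  rw [hz, ← hρ] at k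
  rw [show (α n : ℂ) * (r * z₀) * x n 0 = α n * (r * z₀ * x n 0) by ring] at e1
  have e2 : normSq (x (n + 1) 1) - normSq (x (n + 1) 0) =
      r⁻¹ * (normSq (x n 1) - r ^ 2 * normSq (x n 0)) := by
    apply mul_left_cancel₀ hρ0.ne'
    rw [mul_sub, e1, e0, ← mul_sub, k]
    ring
  rw [e2, vecSq]
  have i1 : 1 + ε ≤ r⁻¹ := by
    rw [← one_div, le_div_iff₀ hr0, hr]; nlinarith
  have i2 : r⁻¹ * (normSq (x n 1) - r ^ 2 * normSq (x n 0)) =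
      r⁻¹ * normSq (x n 1) - r * normSq (x n 0) := by field_simp
  rw [i2]
  have i3 := mul_le_mul_of_nonneg_right i1 (normSq_nonneg (x n 1))
  rw [hr] at i3 ⊢
  linarith

theorem sum_vecSq_le {α : ℕ → 𝔻} {z₀ : Circle} {ε : ℝ} (hε : 0 < ε) (hε' : ε < 1)
    {x : ℕ → Fin 2 → ℂ} (hx : IsSzegoSolution α z₀ (1 - ε) x) (N : ℕ) :
    ε * ∑ n ∈ Finset.range N, vecSq (x n) ≤
      normSq (x N 1) + (normSq (x 0 0) - normSq (x 0 1)) := by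
  have h : ε * ∑ n ∈ Finset.range N, vecSq (x n) ≤
      normSq (x N 1) - normSq (x N 0) + (normSq (x 0 0) - normSq (x 0 1)) := by
    induction N with
    | zero => simp
    | succ N ih =>
      rw [Finset.sum_range_succ, mul_add]
      linarith [isSzegoSolution_step hε hε' hx N]
  linarith [normSq_nonneg (x N 0)]

theorem sq_integral_le {Ω : Type*} [MeasurableSpace Ω] (ν : Measure Ω) [IsProbabilityMeasure ν]
    {g : Ω → ℝ} (hg : Integrable g ν) (hg2 : Integrable (fun w => g w ^ 2) ν) :
    (∫ w, g w ∂ν) ^ 2 ≤ ∫ w, g w ^ 2 ∂ν := by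
  set m := ∫ w, g w ∂ν with hm
  have h : 0 ≤ ∫ w, (g w ^ 2 - 2 * m * g w + m ^ 2) ∂ν :=
    integral_nonneg fun w => by
      change 0 ≤ g w ^ 2 - 2 * m * g w + m ^ 2
      nlinarith [sq_nonneg (g w - m)]
  have hi : Integrable (fun w => g w ^ 2 - 2 * m * g w) ν := hg2.sub (hg.const_mul _)
  rw [integral_add hi (integrable_const _), integral_sub hg2 (hg.const_mul _), integral_const_mul, integral_const, probReal_univ, one_smul,
    ← hm] at h
  linarith

theorem eval_szegoDual {n : ℕ} {P : ℂ[X]} (hP : P.natDegree ≤ n) (w : Circle) :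
    (szegoDual n P).eval (w : ℂ) = (w : ℂ) ^ n * conj (P.eval (w : ℂ)) := by
  have hw := Circle.coe_ne_zero w
  let i : Invertible ((w : ℂ)⁻¹) := invertibleOfNonzero (inv_ne_zero hw)
  have h := eval₂_reflect_mul_pow (RingHom.id ℂ) ((w : ℂ)⁻¹) n (P.map (starRingEnd ℂ))
    (natDegree_map_le.trans hP)
  rw [invOf_eq_inv, inv_inv, ← eval, ← eval, ← Circle.coe_inv, Circle.coe_inv_eq_conj,
    eval_map_apply] at h
  rw [← h, szegoDual, ← Circle.coe_inv_eq_conj, Circle.coe_inv, inv_pow]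
  field_simp

theorem continuous_eval_circle (P : ℂ[X]) : Continuous fun w : Circle => P.eval (w : ℂ) :=
  P.continuous.comp (by fun_prop)

theorem monicOrthogonal_zero {ν : Measure Circle} {Φ : ℕ → ℂ[X]}
    (hΦ : ∀ n, (Φ n).Monic ∧ (Φ n).natDegree = n ∧
      ∀ k < n, ∫ w : Circle, conj ((w : ℂ) ^ k) * (Φ n).eval (w : ℂ) ∂ν = 0) : Φ 0 = 1 :=
  eq_one_of_monic_natDegree_zero (hΦ 0).1 (hΦ 0).2.1

/-! ### Norms of the orthogonal polynomials and the Weyl recursion. -/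

section OrthogonalPolynomials

variable {ν : Measure Circle} [IsProbabilityMeasure ν] {β : ℕ → 𝔻} {Φ : ℕ → ℂ[X]}

theorem integral_conj_eval_mul_eq_zero
    (hΦ : ∀ n, (Φ n).Monic ∧ (Φ n).natDegree = n ∧
      ∀ k < n, ∫ w : Circle, conj ((w : ℂ) ^ k) * (Φ n).eval (w : ℂ) ∂ν = 0)
    {n : ℕ} {Q : ℂ[X]} (hQ : Q.natDegree < n) :
    ∫ w : Circle, conj (Q.eval (w : ℂ)) * (Φ n).eval (w : ℂ) ∂ν = 0 := by
  have h : ∀ w : Circle, conj (Q.eval (w : ℂ)) * (Φ n).eval (w : ℂ) =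
      ∑ k ∈ Finset.range n, conj (Q.coeff k) * (conj ((w : ℂ) ^ k) * (Φ n).eval (w : ℂ)) := by
    intro w
    rw [eval_eq_sum_range' hQ, map_sum, Finset.sum_mul]
    refine Finset.sum_congr rfl fun k _ => ?_
    rw [map_mul]; ring
  simp only [h]
  rw [integral_finsetSum]
  · refine Finset.sum_eq_zero fun k hk => ?_
    rw [integral_const_mul, (hΦ n).2.2 k (Finset.mem_range.1 hk), mul_zero]
  · intro k _
    refine Circle.integrable_of_continuous ν ?_
    have := continuous_eval_circle (Φ n)
    fun_prop

/-- Pythagoras in `w Φₙ = Φₙ₊₁ + conj βₙ Φₙ*`: the dual has degree at most `n`, so it is orthogonal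
to `Φₙ₊₁`, and `|Φₙ*| = |Φₙ|` on the circle. -/
theorem integral_normSq_eval_succ
    (hΦ : ∀ n, (Φ n).Monic ∧ (Φ n).natDegree = n ∧
      ∀ k < n, ∫ w : Circle, conj ((w : ℂ) ^ k) * (Φ n).eval (w : ℂ) ∂ν = 0)
    (hrec : ∀ n, Φ (n + 1) = X * Φ n - C (conj (β n : ℂ)) * szegoDual n (Φ n)) (n : ℕ) :
    ∫ w : Circle, normSq ((Φ (n + 1)).eval (w : ℂ)) ∂ν =
      rho (β n) ^ 2 * ∫ w : Circle, normSq ((Φ n).eval (w : ℂ)) ∂ν := by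
  have c0 := continuous_eval_circle (Φ n)
  have c1 := continuous_eval_circle (Φ (n + 1))
  have c2 := continuous_eval_circle (szegoDual n (Φ n))
  have hdeg : (szegoDual n (Φ n)).natDegree < n + 1 := by
    have h1 := natDegree_reflect_le (N := n) (p := (Φ n).map (starRingEnd ℂ))
    have h2 : ((Φ n).map (starRingEnd ℂ)).natDegree ≤ n := natDegree_map_le.trans (hΦ n).2.1.le
    rw [max_eq_left h2] at h1
    exact Nat.lt_succ_of_le h1
  have horth := integral_conj_eval_mul_eq_zero hΦ hdeg
  have hpt : ∀ w : Circle, normSq ((Φ n).eval (w : ℂ)) = normSq ((Φ (n + 1)).eval (w : ℂ)) +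
      normSq (β n : ℂ) * normSq ((Φ n).eval (w : ℂ)) +
      2 * ((β n : ℂ) * (conj ((szegoDual n (Φ n)).eval (w : ℂ)) *
        (Φ (n + 1)).eval (w : ℂ))).re := by
    intro w
    have e1 : normSq ((szegoDual n (Φ n)).eval (w : ℂ)) = normSq ((Φ n).eval (w : ℂ)) := by
      rw [eval_szegoDual (hΦ n).2.1.le, normSq_mul, map_pow, Circle.normSq_coe, one_pow, one_mul,
        normSq_conj]
    have e2 : normSq ((w : ℂ) * (Φ n).eval (w : ℂ)) = normSq ((Φ n).eval (w : ℂ)) := by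
      rw [normSq_mul, Circle.normSq_coe, one_mul]
    have e3 : (w : ℂ) * (Φ n).eval (w : ℂ) = (Φ (n + 1)).eval (w : ℂ) +
        conj (β n : ℂ) * (szegoDual n (Φ n)).eval (w : ℂ) := by
      rw [hrec n]; simp
    have e4 := congrArg normSq e3
    rw [e2, normSq_add, normSq_mul, normSq_conj, e1, map_mul, conj_conj] at e4
    refine e4.trans ?_
    congr 3
    ring
  have hint : ∫ w : Circle, ((β n : ℂ) * (conj ((szegoDual n (Φ n)).eval (w : ℂ)) *
        (Φ (n + 1)).eval (w : ℂ))).re ∂ν = 0 := by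
    have := integral_re (𝕜 := ℂ) (μ := ν) (f := fun w : Circle => (β n : ℂ) *
      (conj ((szegoDual n (Φ n)).eval (w : ℂ)) * (Φ (n + 1)).eval (w : ℂ)))
      (Circle.integrable_of_continuous ν (by fun_prop))
    rw [integral_const_mul, horth, mul_zero] at this
    simpa using this
  have i0 : Integrable (fun w : Circle => normSq ((Φ n).eval (w : ℂ))) ν :=
    Circle.integrable_of_continuous ν (continuous_normSq.comp c0)
  have i1 : Integrable (fun w : Circle => normSq ((Φ (n + 1)).eval (w : ℂ))) ν :=
    Circle.integrable_of_continuous ν (continuous_normSq.comp c1)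
  have i2 : Integrable (fun w : Circle => ((β n : ℂ) *
      (conj ((szegoDual n (Φ n)).eval (w : ℂ)) * (Φ (n + 1)).eval (w : ℂ))).re) ν :=
    Circle.integrable_of_continuous ν (by fun_prop)
  have h : ∫ w : Circle, normSq ((Φ n).eval (w : ℂ)) ∂ν =
      ∫ w : Circle, normSq ((Φ (n + 1)).eval (w : ℂ)) ∂ν +
      normSq (β n : ℂ) * ∫ w : Circle, normSq ((Φ n).eval (w : ℂ)) ∂ν := by
    conv_lhs => rw [integral_congr_ae (ae_of_all ν hpt)]
    have i3 : Integrable (fun w : Circle => normSq ((Φ (n + 1)).eval (w : ℂ)) +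
        normSq (β n : ℂ) * normSq ((Φ n).eval (w : ℂ))) ν := i1.add (i0.const_mul _)
    rw [integral_add i3 (i2.const_mul _), integral_add i1 (i0.const_mul _),
      integral_const_mul, integral_const_mul, hint]
    ring
  have hρ : rho (β n) ^ 2 = 1 - normSq (β n : ℂ) := by
    rw [rho, Real.sq_sqrt (by linarith [(β n).sq_norm_lt_one]), normSq_eq_norm_sq]
  rw [hρ]
  linarith

theorem integral_normSq_eval
    (hΦ : ∀ n, (Φ n).Monic ∧ (Φ n).natDegree = n ∧
      ∀ k < n, ∫ w : Circle, conj ((w : ℂ) ^ k) * (Φ n).eval (w : ℂ) ∂ν = 0)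
    (hrec : ∀ n, Φ (n + 1) = X * Φ n - C (conj (β n : ℂ)) * szegoDual n (Φ n)) (n : ℕ) :
    ∫ w : Circle, normSq ((Φ n).eval (w : ℂ)) ∂ν = ∏ j ∈ Finset.range n, rho (β j) ^ 2 := by
  induction n with
  | zero => simp [monicOrthogonal_zero hΦ]
  | succ n ih => rw [integral_normSq_eval_succ hΦ hrec, ih, Finset.prod_range_succ, mul_comm]

/-- The Weyl solution `(∫ conj Φₙ^* w / (w - z) dν, ∫ conj Φₙ w / (w - z) dν - δₙ₀)`. -/
noncomputable def weylCoord (ν : Measure Circle) (Φ : ℕ → ℂ[X]) (z : ℂ) (n : ℕ) : ℂ × ℂ :=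
  (∫ w : Circle, conj ((szegoDual n (Φ n)).eval (w : ℂ)) * ((w : ℂ) / ((w : ℂ) - z)) ∂ν,
    ∫ w : Circle, conj ((Φ n).eval (w : ℂ)) * ((w : ℂ) / ((w : ℂ) - z)) ∂ν -
      if n = 0 then 1 else 0)

theorem continuous_div_sub {z : ℂ} (hz : ‖z‖ < 1) :
    Continuous fun w : Circle => (w : ℂ) / ((w : ℂ) - z) :=
  Continuous.div (by fun_prop) (by fun_prop) (Circle.sub_ne_zero_of_norm_lt hz)

theorem weylCoord_succ
    (hΦ : ∀ n, (Φ n).Monic ∧ (Φ n).natDegree = n ∧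
      ∀ k < n, ∫ w : Circle, conj ((w : ℂ) ^ k) * (Φ n).eval (w : ℂ) ∂ν = 0)
    (hrec : ∀ n, Φ (n + 1) = X * Φ n - C (conj (β n : ℂ)) * szegoDual n (Φ n)) {z : ℂ}
    (hz : ‖z‖ < 1) (n : ℕ) :
    z * (weylCoord ν Φ z (n + 1)).1 =
        z * (weylCoord ν Φ z n).1 - conj (β n : ℂ) * (weylCoord ν Φ z n).2 ∧
      z * (weylCoord ν Φ z (n + 1)).2 =
        (weylCoord ν Φ z n).2 - β n * (z * (weylCoord ν Φ z n).1) := by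
  have c0 := continuous_eval_circle (Φ n)
  have c2 := continuous_eval_circle (szegoDual n (Φ n))
  have ch := continuous_div_sub hz
  have iq : Integrable (fun w : Circle => conj ((szegoDual n (Φ n)).eval (w : ℂ)) *
      ((w : ℂ) / ((w : ℂ) - z))) ν := Circle.integrable_of_continuous ν (by fun_prop)
  have ip : Integrable (fun w : Circle => conj ((Φ n).eval (w : ℂ)) *
      ((w : ℂ) / ((w : ℂ) - z))) ν := Circle.integrable_of_continuous ν (by fun_prop)
  have ip1 : Integrable (fun w : Circle => conj ((Φ n).eval (w : ℂ))) ν :=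
    Circle.integrable_of_continuous ν (by fun_prop)
  have hone : ∫ w : Circle, conj ((Φ n).eval (w : ℂ)) ∂ν = if n = 0 then 1 else 0 := by
    rw [integral_conj]
    by_cases h : n = 0
    · subst h
      simp [monicOrthogonal_zero hΦ]
    · have := (hΦ n).2.2 0 (Nat.pos_of_ne_zero h)
      simp only [pow_zero, map_one, one_mul] at this
      rw [this, if_neg h, map_zero]
  have hb : (weylCoord ν Φ z n).2 = ∫ w : Circle, (conj ((Φ n).eval (w : ℂ)) *
      ((w : ℂ) / ((w : ℂ) - z)) - conj ((Φ n).eval (w : ℂ))) ∂ν := by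
    rw [integral_sub ip ip1, hone, weylCoord]
  have hp : ∀ w : Circle, (Φ (n + 1)).eval (w : ℂ) = (w : ℂ) * (Φ n).eval (w : ℂ) -
      conj (β n : ℂ) * (szegoDual n (Φ n)).eval (w : ℂ) := by
    intro w; rw [hrec n]; simp
  have hq : ∀ w : Circle, (szegoDual (n + 1) (Φ (n + 1))).eval (w : ℂ) =
      (szegoDual n (Φ n)).eval (w : ℂ) - β n * ((w : ℂ) * (Φ n).eval (w : ℂ)) := by
    intro w
    have hw := Circle.coe_ne_zero w
    rw [eval_szegoDual (hΦ (n + 1)).2.1.le, hp, eval_szegoDual (hΦ n).2.1.le]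
    simp only [map_sub, map_mul, map_pow, conj_conj]
    rw [← Circle.coe_inv_eq_conj, Circle.coe_inv, inv_pow]
    field_simp
    ring
  -- As `conj w = w⁻¹`, the kernel becomes `z / (w - z) = w / (w - z) - 1`. The subtracted `1`
  -- integrates to the `δₙ₀` in the second Weyl coordinate.
  have hkey : ∀ w : Circle, z * (conj ((w : ℂ) * (Φ n).eval (w : ℂ)) * ((w : ℂ) / ((w : ℂ) - z))) =
      conj ((Φ n).eval (w : ℂ)) * ((w : ℂ) / ((w : ℂ) - z)) - conj ((Φ n).eval (w : ℂ)) := by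
    intro w
    have hw := Circle.coe_ne_zero w
    have hw' := Circle.sub_ne_zero_of_norm_lt hz w
    rw [map_mul, ← Circle.coe_inv_eq_conj, Circle.coe_inv]
    field_simp
    ring
  have ipp : Integrable (fun w : Circle => conj ((Φ n).eval (w : ℂ)) *
      ((w : ℂ) / ((w : ℂ) - z)) - conj ((Φ n).eval (w : ℂ))) ν := ip.sub ip1
  constructor
  · rw [hb]
    simp only [weylCoord]
    rw [← integral_const_mul, ← integral_const_mul, ← integral_const_mul,
      ← integral_sub (iq.const_mul _) (ipp.const_mul _)]
    refine integral_congr_ae (ae_of_all ν fun w => ?_)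
    simp only [← hkey w]
    rw [hq, map_sub, map_mul (starRingEnd ℂ) (β n : ℂ)]
    ring
  · rw [hb]
    simp only [weylCoord, Nat.succ_ne_zero, if_false, sub_zero]
    rw [← integral_const_mul, ← integral_const_mul, ← integral_const_mul,
      ← integral_sub ipp ((iq.const_mul _).const_mul _)]
    refine integral_congr_ae (ae_of_all ν fun w => ?_)
    simp only [← hkey w]
    rw [hp, map_sub, map_mul (starRingEnd ℂ) (conj (β n : ℂ)), conj_conj]
    ring

theorem weylCoord_zero
    (hΦ : ∀ n, (Φ n).Monic ∧ (Φ n).natDegree = n ∧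
      ∀ k < n, ∫ w : Circle, conj ((w : ℂ) ^ k) * (Φ n).eval (w : ℂ) ∂ν = 0) {z : ℂ}
    (hz : ‖z‖ < 1) :
    2 * (weylCoord ν Φ z 0).1 = caratheodory ν z + 1 ∧
      2 * (weylCoord ν Φ z 0).2 = caratheodory ν z - 1 := by
  have hF : caratheodory ν z = 2 * ∫ w : Circle, (w : ℂ) / ((w : ℂ) - z) ∂ν - 1 := by
    have i := Circle.integrable_of_continuous ν (continuous_div_sub hz)
    have : ∀ w : Circle, ((w : ℂ) + z) / ((w : ℂ) - z) = 2 * ((w : ℂ) / ((w : ℂ) - z)) - 1 := by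
      intro w
      have hw' := Circle.sub_ne_zero_of_norm_lt hz w
      field_simp
      ring
    simp only [caratheodory, this]
    rw [integral_sub (i.const_mul _) (integrable_const _), integral_const_mul, integral_const,
      probReal_univ, one_smul]
  have e1 := monicOrthogonal_zero hΦ
  have e2 : szegoDual 0 (1 : ℂ[X]) = 1 := by
    rw [szegoDual, Polynomial.map_one, ← C_1, reflect_C, pow_zero, mul_one]
  simp only [weylCoord, e1, e2, map_one, one_mul, if_true, eval_one, hF]
  constructor <;> ring

/-- Cauchy–Schwarz with the norm of `Φₙ`. Its product of `ρ²` cancels the normalization of the Szegő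
matrices and leaves geometric decay. -/
theorem normSq_weylCoord_le
    (hΦ : ∀ n, (Φ n).Monic ∧ (Φ n).natDegree = n ∧
      ∀ k < n, ∫ w : Circle, conj ((w : ℂ) ^ k) * (Φ n).eval (w : ℂ) ∂ν = 0)
    (hrec : ∀ n, Φ (n + 1) = X * Φ n - C (conj (β n : ℂ)) * szegoDual n (Φ n)) {z : ℂ}
    (hz : ‖z‖ < 1) {n : ℕ} (hn : n ≠ 0) :
    normSq (weylCoord ν Φ z n).2 ≤
      (∏ j ∈ Finset.range n, rho (β j) ^ 2) * ((1 - ‖z‖) ^ 2)⁻¹ := by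
  have c0 := continuous_eval_circle (Φ n)
  have hz0 : 0 < 1 - ‖z‖ := by linarith
  have hh : ∀ w : Circle, ‖(w : ℂ) / ((w : ℂ) - z)‖ ≤ (1 - ‖z‖)⁻¹ := by
    intro w
    have h2 : 1 - ‖z‖ ≤ ‖(w : ℂ) - z‖ := by
      have := norm_sub_norm_le (w : ℂ) z
      rwa [Circle.norm_coe] at this
    rw [norm_div, Circle.norm_coe, one_div]
    exact inv_anti₀ hz0 h2
  have i1 : Integrable (fun w : Circle => ‖(Φ n).eval (w : ℂ)‖) ν :=
    Circle.integrable_of_continuous ν c0.norm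
  have i2 : Integrable (fun w : Circle => ‖(Φ n).eval (w : ℂ)‖ ^ 2) ν :=
    Circle.integrable_of_continuous ν (c0.norm.pow 2)
  have h1 : ‖(weylCoord ν Φ z n).2‖ ≤
      (∫ w : Circle, ‖(Φ n).eval (w : ℂ)‖ ∂ν) * (1 - ‖z‖)⁻¹ := by
    simp only [weylCoord, if_neg hn, sub_zero]
    rw [← integral_mul_const]
    refine norm_integral_le_of_norm_le (i1.mul_const _) (ae_of_all ν fun w => ?_)
    rw [norm_mul, RCLike.norm_conj]
    exact mul_le_mul_of_nonneg_left (hh w) (norm_nonneg _)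
  have h2 := sq_integral_le ν i1 i2
  have h3 := integral_normSq_eval hΦ hrec n
  simp only [normSq_eq_norm_sq] at h3 ⊢
  rw [h3] at h2
  calc _ ≤ ((∫ w : Circle, ‖(Φ n).eval (w : ℂ)‖ ∂ν) * (1 - ‖z‖)⁻¹) ^ 2 := by gcongr
    _ ≤ _ := by rw [mul_pow, inv_pow]; gcongr

end OrthogonalPolynomials

theorem rho_circle_smul (φ : Circle) (α : 𝔻) : rho (φ • α) = rho α := by
  rw [rho, rho, UnitDisc.coe_circle_smul, norm_mul, Circle.norm_coe, one_mul]

theorem norm_caratheodory_le_of_verblunsky {ν : Measure Circle} [IsProbabilityMeasure ν]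
    {α : ℕ → 𝔻} {φ : Circle} (hν : HasVerblunskyCoefficients ν fun n => φ • α n) {z₀ : Circle}
    {ε B : ℝ} (hε : 0 < ε) (hε' : ε ≤ 1 / 6)
    (hB : ∀ n : ℕ, (n : ℝ) ≤ ε⁻¹ →
      frobSq (transfer (fun j => szegoMatrix (α j) z₀) n) ≤ B) :
    ‖caratheodory ν ((1 - ε) * z₀)‖ ≤ 400 * B := by
  obtain ⟨-, Φ, hΦ, hrec⟩ := hν
  have hzn := norm_one_sub_mul_circle (by linarith : ε < 1) z₀
  set r := 1 - ε with hr
  have hr0 : 0 < r := by linarith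
  have hr1 : r < 1 := by linarith
  have hzr : ((1 - ε : ℂ)) * (z₀ : ℂ) = (r : ℂ) * z₀ := by rw [hr]; push_cast; ring
  rw [hzr] at hzn ⊢
  set z : ℂ := (r : ℂ) * z₀ with hz
  have hz1 : ‖z‖ < 1 := by rw [hzn]; exact hr1
  set F := caratheodory ν z with hF
  have hFre : 0 ≤ F.re := re_caratheodory_nonneg ν hz1
  -- The factors `c n` normalize the recursion, and `conj φ` in the second coordinate below removes
  -- the phase, so that the transfer matrices are those of the unrotated `α`.
  set c : ℕ → ℂ := fun n => ∏ j ∈ Finset.range n, (invSqrt z₀ r * z / rho (α j)) with hc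
  set x : ℕ → Fin 2 → ℂ := fun n =>
    ![c n * (weylCoord ν Φ z n).1, c n * (conj (φ : ℂ) * (weylCoord ν Φ z n).2)] with hxdef
  have hφ : conj (φ : ℂ) * φ = 1 := by
    rw [← normSq_eq_conj_mul_self, Circle.normSq_coe, ofReal_one]
  have hx : IsSzegoSolution α z₀ r x := by
    intro n
    have hρ := rho_ne_zero (α n)
    obtain ⟨h1, h2⟩ := weylCoord_succ hΦ hrec hz1 n
    simp only [UnitDisc.coe_circle_smul, map_mul] at h1 h2
    have hcs : (rho (α n) : ℂ) * c (n + 1) = c n * (invSqrt z₀ r * z) := by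
      simp only [hc, Finset.prod_range_succ]
      field_simp
    simp only [hxdef, Matrix.cons_val_zero, Matrix.cons_val_one, ← hz]
    constructor
    · linear_combination (weylCoord ν Φ z (n + 1)).1 * hcs + c n * invSqrt z₀ r * h1
    · linear_combination conj (φ : ℂ) * (weylCoord ν Φ z (n + 1)).2 * hcs +
        c n * invSqrt z₀ r * conj (φ : ℂ) * h2 -
        c n * invSqrt z₀ r * (α n * z * (weylCoord ν Φ z n).1) * hφ
  obtain ⟨w1, w2⟩ := weylCoord_zero (ν := ν) hΦ hz1
  have hx0 : normSq (x 0 0) = normSq (F + 1) / 4 ∧ normSq (x 0 1) = normSq (F - 1) / 4 := by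
    have n4 : normSq (2 : ℂ) = 4 := by rw [normSq_ofNat]; norm_num
    simp only [hxdef, hc, Finset.range_zero, Finset.prod_empty, one_mul, Matrix.cons_val_zero,
      Matrix.cons_val_one, normSq_mul, normSq_conj, Circle.normSq_coe]
    rw [← hF] at w1 w2
    rw [← w1, ← w2, normSq_mul, normSq_mul, n4]
    constructor <;> ring
  have hJ : normSq (x 0 0) - normSq (x 0 1) = F.re := by
    rw [hx0.1, hx0.2]
    simp only [normSq_apply, add_re, add_im, sub_re, sub_im, one_re, one_im]
    ring
  have hdecay : ∀ N : ℕ, N ≠ 0 → normSq (x N 1) ≤ r ^ N * (ε ^ 2)⁻¹ := by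
    intro N hN
    have h1 := normSq_weylCoord_le (ν := ν) hΦ hrec hz1 hN
    simp only [rho_circle_smul] at h1
    rw [hzn, hr, sub_sub_cancel] at h1
    have h2 : normSq (c N) * ∏ j ∈ Finset.range N, rho (α j) ^ 2 = r ^ N := by
      simp only [hc]
      rw [map_prod, ← Finset.prod_mul_distrib]
      have : ∀ j ∈ Finset.range N, normSq (invSqrt z₀ r * z / rho (α j)) * rho (α j) ^ 2 = r := by
        intro j _
        have hρ := (rho_pos (α j)).ne'
        rw [normSq_div, normSq_mul, normSq_invSqrt z₀ hr0, normSq_ofReal, normSq_eq_norm_sq z, hzn]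
        field_simp
      rw [Finset.prod_congr rfl this, Finset.prod_const, Finset.card_range]
    simp only [hxdef, Matrix.cons_val_one, Matrix.cons_val_zero, normSq_mul, normSq_conj,
      Circle.normSq_coe, one_mul]
    calc _ ≤ normSq (c N) * ((∏ j ∈ Finset.range N, rho (α j) ^ 2) * (ε ^ 2)⁻¹) :=
          mul_le_mul_of_nonneg_left h1 (normSq_nonneg _)
      _ = r ^ N * (ε ^ 2)⁻¹ := by rw [← mul_assoc, h2]
  -- The gain of the indefinite form telescopes up to `N`; its initial contribution is `Re F` by
  -- `hJ`, and the boundary term vanishes as `N → ∞` by `hdecay`.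
  have hsum : ∀ L : ℕ, ε * ∑ n ∈ Finset.range L, vecSq (x n) ≤ F.re := by
    intro L
    have ht : Filter.Tendsto (fun N : ℕ => r ^ N * (ε ^ 2)⁻¹ + F.re) Filter.atTop
        (nhds (0 * (ε ^ 2)⁻¹ + F.re)) :=
      ((tendsto_pow_atTop_nhds_zero_of_lt_one hr0.le hr1).mul_const _).add_const _
    rw [zero_mul, zero_add] at ht
    refine ge_of_tendsto ht ?_
    filter_upwards [Filter.eventually_ge_atTop (L + 1)] with N hN
    have h1 := sum_vecSq_le hε (by linarith) hx N
    rw [hJ] at h1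
    have h2 : ∑ n ∈ Finset.range L, vecSq (x n) ≤ ∑ n ∈ Finset.range N, vecSq (x n) :=
      Finset.sum_le_sum_of_subset_of_nonneg (Finset.range_subset_range.2 (by omega))
        fun n _ _ => vecSq_nonneg _
    have h3 := mul_le_mul_of_nonneg_left h2 hε.le
    linarith [hdecay N (by omega)]
  obtain ⟨L, hL⟩ := vecSq_le_of_isSzegoSolution hε hε' hx hB
  have hB0 : 0 ≤ B := (frobSq_nonneg _).trans (hB 0 (by simpa using hε.le))
  have h1 : vecSq (x 0) ≤ 100 * B * F.re := by
    calc _ ≤ 100 * B * (ε * ∑ n ∈ Finset.range (L + 1), vecSq (x n)) := hL.trans (le_of_eq (by ring))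
      _ ≤ _ := by gcongr; exact hsum _
  have h2 : ‖F‖ ^ 2 ≤ 4 * vecSq (x 0) := by
    rw [vecSq, hx0.1, hx0.2, ← normSq_eq_norm_sq]
    simp only [normSq_apply, add_re, add_im, sub_re, sub_im, one_re, one_im]
    nlinarith [sq_nonneg F.re, sq_nonneg F.im]
  have h3 : ‖F‖ ^ 2 ≤ 400 * B * ‖F‖ := by
    have := mul_le_mul_of_nonneg_left (re_le_norm F) (by positivity : 0 ≤ 400 * B)
    linarith
  rcases (norm_nonneg F).eq_or_lt with h | h
  · rw [← h]; positivity
  · exact le_of_mul_le_mul_right (by linarith [sq ‖F‖]) h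

/-! ### Growth of the cocycle -/

theorem frobSq_le_norm_sq (A : Matrix (Fin 2) (Fin 2) ℂ) : frobSq A ≤ 2 * ‖A‖ ^ 2 := by
  have h : ∀ i : Fin 2, colSq A i ≤ ‖A‖ ^ 2 := by
    intro i
    have h1 := Matrix.l2_opNorm_mulVec A (EuclideanSpace.single i (1 : ℂ))
    rw [EuclideanSpace.single, PiLp.norm_single, norm_one, mul_one] at h1
    have h2 := pow_le_pow_left₀ (norm_nonneg _) h1 2
    rw [EuclideanSpace.norm_sq_eq] at h2
    simpa [colSq, vecSq, Fin.sum_univ_two, normSq_eq_norm_sq] using h2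
  rw [frobSq_eq_colSq]
  linarith [h 0, h 1]

/-- The sampling function has constant modulus `lam < 1`, so the bound needs no regularity of `h`.
-/
theorem exists_norm_szegoMatrix_sampling_le {d : ℕ} (lam : Ioo (0 : ℝ) 1)
    (h : UnitAddTorus (Fin d) → ℝ) (z : ℂ) :
    ∃ K, 0 ≤ K ∧ ∀ x, ‖szegoMatrix (sampling lam h x) z‖ ≤ K := by
  have hα : ∀ x, ‖(sampling lam h x : ℂ)‖ = lam := by
    intro x
    have h1 : ‖Complex.exp (2 * Real.pi * I * (h x : ℂ))‖ = 1 := by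
      rw [Complex.norm_exp]; simp
    rw [sampling, UnitDisc.coe_mk, norm_mul, h1, mul_one, Complex.norm_real,
      Real.norm_of_nonneg lam.2.1.le]
  refine ⟨‖z ^ (-(1 / 2) : ℂ)‖ * ‖(√(1 - (lam : ℝ) ^ 2))⁻¹‖ *
    (‖(!![z, 0; 0, 1] : Matrix (Fin 2) (Fin 2) ℂ)‖ +
      ‖(!![0, 1; 0, 0] : Matrix (Fin 2) (Fin 2) ℂ)‖ +
      ‖(!![0, 0; z, 0] : Matrix (Fin 2) (Fin 2) ℂ)‖), by positivity, fun x => ?_⟩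
  set a := sampling lam h x with ha
  have hdec : (!![z, -conj (a : ℂ); -(a : ℂ) * z, 1] : Matrix (Fin 2) (Fin 2) ℂ) =
      !![z, 0; 0, 1] + -conj (a : ℂ) • !![0, 1; 0, 0] + -(a : ℂ) • !![0, 0; z, 0] := by
    ext i j
    fin_cases i <;> fin_cases j <;> simp
  have hρ : rho a = √(1 - (lam : ℝ) ^ 2) := by rw [rho, ha, hα]
  rw [szegoMatrix, hdec, norm_smul, norm_mul, hρ, Complex.norm_real]
  have hl : (lam : ℝ) ≤ 1 := lam.2.2.le
  refine mul_le_mul_of_nonneg_left ?_ (by positivity)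
  refine (norm_add_le _ _).trans (add_le_add ((norm_add_le _ _).trans (add_le_add le_rfl ?_)) ?_)
  · rw [norm_smul, norm_neg, RCLike.norm_conj, ha, hα]
    exact mul_le_of_le_one_left (norm_nonneg _) hl
  · rw [norm_smul, norm_neg, ha, hα]
    exact mul_le_of_le_one_left (norm_nonneg _) hl

section Growth

variable {d : ℕ} (lam : Ioo (0 : ℝ) 1) (h : UnitAddTorus (Fin d) → ℝ) (ω : Fin d → ℝ)

/-- Needed because a real supremum over an unbounded set is `0` and would dominate nothing. -/
theorem bddAbove_norm_cocycle (z : ℂ) (n : ℕ) :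
    BddAbove (range fun x => ‖cocycle (sampling lam h) ω z n x‖) := by
  obtain ⟨K, hK0, hK⟩ := exists_norm_szegoMatrix_sampling_le lam h z
  induction n with
  | zero => exact ⟨‖(1 : Matrix (Fin 2) (Fin 2) ℂ)‖, by rintro _ ⟨x, rfl⟩; rfl⟩
  | succ n ih =>
    obtain ⟨M, hM⟩ := ih
    refine ⟨K * M, ?_⟩
    rintro _ ⟨x, rfl⟩
    have := hM ⟨x, rfl⟩
    exact (Matrix.l2_opNorm_mul _ _).trans (mul_le_mul (hK _) this (norm_nonneg _) hK0)

theorem norm_sq_cocycle_le_cocycleGrowth (z : ℂ) {R : ℝ} {n : ℕ} (hn : (n : ℝ) ≤ R)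
    (x : UnitAddTorus (Fin d)) :
    ‖cocycle (sampling lam h) ω z n x‖ ^ 2 ≤ cocycleGrowth (sampling lam h) ω z R := by
  have hfin : Finite {s : ℕ // (s : ℝ) ≤ R} := by
    refine Set.Finite.to_subtype (Set.Finite.subset (finite_Iic ⌊R⌋₊) fun s hs => ?_)
    exact Nat.le_floor hs
  have h1 : ‖cocycle (sampling lam h) ω z n x‖ ≤ cocycleNorm (sampling lam h) ω z n :=
    le_ciSup (bddAbove_norm_cocycle lam h ω z n) x
  exact (pow_le_pow_left₀ (norm_nonneg _) h1 2).trans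
    (le_ciSup (f := fun s : {s : ℕ // (s : ℝ) ≤ R} => cocycleNorm (sampling lam h) ω z s ^ 2)
      (finite_range _).bddAbove ⟨n, hn⟩)

theorem one_le_cocycleGrowth (z : ℂ) {R : ℝ} (hR : 0 ≤ R) :
    1 ≤ cocycleGrowth (sampling lam h) ω z R := by
  have := norm_sq_cocycle_le_cocycleGrowth lam h ω z (n := 0) (by simpa using hR) 0
  rwa [cocycle, CStarRing.norm_one, one_pow] at this

/-- Products starting at index `k` are the cocycle based at `x + (k - 1) ω`; the supremum over the
torus makes the base point irrelevant. -/
theorem frobSq_transfer_verblunsky_le (z : ℂ) {R : ℝ} (x : UnitAddTorus (Fin d)) (k n : ℕ)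
    (hn : (n : ℝ) ≤ R) :
    frobSq (transfer (fun j => szegoMatrix
      (verblunsky (sampling lam h) ω x ((k + j : ℕ) : ℤ)) z) n) ≤
      2 * cocycleGrowth (sampling lam h) ω z R := by
  have e : ∀ n : ℕ, transfer (fun j => szegoMatrix
      (verblunsky (sampling lam h) ω x ((k + j : ℕ) : ℤ)) z) n =
      cocycle (sampling lam h) ω z n (x + ((k : ℤ) - 1) • toTorus ω) := by
    intro n
    induction n with
    | zero => rfl
    | succ n ih =>
      rw [transfer, cocycle, ih, verblunsky, add_assoc, ← natCast_zsmul, ← add_zsmul]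
      congr 5
      push_cast
      ring
  rw [e]
  linarith [frobSq_le_norm_sq (cocycle (sampling lam h) ω z n (x + ((k : ℤ) - 1) • toTorus ω)),
    norm_sq_cocycle_le_cocycleGrowth lam h ω z hn (x + ((k : ℤ) - 1) • toTorus ω)]

end Growth

/-! ### Carathéodory functions of CMV matrices -/

theorem norm_lpSingle_one {ι : Type*} [DecidableEq ι] (i : ι) :
    ‖(lp.single 2 i (1 : ℂ) : ℓ²(ι, ℂ))‖ = 1 := by
  rw [lp.norm_single (by norm_num), norm_one]

theorem inner_lpSingle_one {ι : Type*} [DecidableEq ι] (i : ι) (u : ℓ²(ι, ℂ)) :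
    ⟪(lp.single 2 i (1 : ℂ) : ℓ²(ι, ℂ)), u⟫_ℂ = u i := by
  rw [lp.inner_single_left]
  simp

theorem BlockData.toUnitary_apply {ι : Type*} (D : BlockData ι) (u : ℓ²(ι, ℂ)) (i : ι) :
    D.toUnitary u i = D.a i * u i + D.b i * u (D.σ i) := rfl

theorem norm_caratheodory_halfLineMeasure_le {α : ℕ → 𝔻} {z₀ : Circle} {ε B : ℝ} (hε : 0 < ε)
    (hε' : ε ≤ 1 / 6)
    (hB : ∀ n : ℕ, (n : ℝ) ≤ ε⁻¹ →
      frobSq (transfer (fun j => szegoMatrix (α j) z₀) n) ≤ B) (hB1 : 1 ≤ B) :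
    ‖caratheodory (halfLineMeasure α) ((1 - ε) * z₀)‖ ≤ 48000 * B := by
  have hzn := norm_one_sub_mul_circle (by linarith : ε < 1) z₀
  have hzr : ((1 - ε : ℂ)) * (z₀ : ℂ) = ((1 - ε : ℝ) : ℂ) * z₀ := by push_cast; ring
  rw [hzr] at hzn ⊢
  have hz1 : ‖((1 - ε : ℝ) : ℂ) * z₀‖ < 1 := by rw [hzn]; linarith
  have hψ : ‖(lp.single 2 0 1 : ℓ²(ℕ, ℂ))‖ = 1 := norm_lpSingle_one 0
  obtain ⟨u, hu, hF⟩ := caratheodory_spectralMeasure (halfLineCMV α) hψ hz1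
  have hres := resolvent_norm_sq hψ hu
  rw [inner_lpSingle_one] at hF hres
  rw [hzn] at hres
  rw [halfLineMeasure, hF]
  set v := (halfLineM α).toUnitary u with hv
  have hLv : (halfLineL α).toUnitary v = (((1 - ε : ℝ) : ℂ) * z₀) • u + lp.single 2 0 1 := hu
  have hM : ∀ n, v n = _ := fun n => (halfLineM α).toUnitary_apply u n
  have hL : ∀ n, (((1 - ε : ℝ) : ℂ) * z₀) * u n + (if n = 0 then 1 else 0) =
      (halfLineL α).a n * v n + (halfLineL α).b n * v ((halfLineL α).σ n) := by
    intro n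
    rw [← (halfLineL α).toUnitary_apply v n, hLv, lp.coeFn_add, lp.coeFn_smul, Pi.add_apply,
      Pi.smul_apply, smul_eq_mul, lp.coeFn_single, Pi.single_apply]
  refine norm_le_of_resolvent_zero (e := id) Function.injective_id (u := u) (v := v) hε hε'
    (LinearIsometryEquiv.norm_map _ _) (one_le_two_mul_norm_resolvent hψ hz1 hu) ?_ ?_ hB hB1 rfl
    hres
  · intro n hn
    have hn' : ¬ Even (n + 1) := by rw [Nat.even_add_one]; exact not_not.2 hn
    have h0 := hL n
    have h1 := hL (n + 1)
    simp only [halfLineL, if_pos hn, if_neg hn', Nat.add_sub_cancel, Nat.succ_ne_zero,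
      if_false, add_zero] at h0 h1
    simp only [id]
    exact ⟨h0, by rw [h1]; ring⟩
  · intro n hn
    have hn' : Even (n + 1) := by rw [Nat.even_add_one]; exact hn
    have hn0 : n ≠ 0 := by rintro rfl; simp at hn
    have h0 := hM n
    have h1 := hM (n + 1)
    simp only [halfLineM, if_neg hn, if_neg hn0, if_pos hn', Nat.add_sub_cancel, Nat.succ_ne_zero,
      if_false] at h0 h1
    simp only [id]
    exact ⟨h0, by rw [h1]; ring⟩

theorem extendedCMV_resolvent {α : ℤ → 𝔻} {z : ℂ} {k : ℤ} {u : ℓ²(ℤ, ℂ)}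
    (hu : extendedCMV α u = z • u + lp.single 2 k 1) :
    (∀ n : ℤ, Even n →
      z * u n + (if n = k then 1 else 0) = conj (α n : ℂ) * (extendedM α).toUnitary u n +
        rho (α n) * (extendedM α).toUnitary u (n + 1) ∧
      z * u (n + 1) + (if n + 1 = k then 1 else 0) = rho (α n) * (extendedM α).toUnitary u n -
        α n * (extendedM α).toUnitary u (n + 1)) ∧
    ∀ n : ℤ, ¬ Even n →
      (extendedM α).toUnitary u n = conj (α n : ℂ) * u n + rho (α n) * u (n + 1) ∧
      (extendedM α).toUnitary u (n + 1) = rho (α n) * u n - α n * u (n + 1) := by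
  set v := (extendedM α).toUnitary u with hv
  have hLv : (extendedL α).toUnitary v = z • u + lp.single 2 k 1 := hu
  have hM : ∀ n, v n = _ := fun n => (extendedM α).toUnitary_apply u n
  have hL : ∀ n, z * u n + (if n = k then 1 else 0) =
      (extendedL α).a n * v n + (extendedL α).b n * v ((extendedL α).σ n) := by
    intro n
    rw [← (extendedL α).toUnitary_apply v n, hLv, lp.coeFn_add, lp.coeFn_smul, Pi.add_apply,
      Pi.smul_apply, smul_eq_mul, lp.coeFn_single, Pi.single_apply]
  constructor
  · intro n hn
    have hn' : ¬ Even (n + 1) := by rw [Int.even_add_one]; exact not_not.2 hn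
    have h0 := hL n
    have h1 := hL (n + 1)
    simp only [extendedL, if_pos hn, if_neg hn', add_sub_cancel_right] at h0 h1
    exact ⟨h0, by rw [h1]; ring⟩
  · intro n hn
    have hn' : Even (n + 1) := by rw [Int.even_add_one]; exact hn
    have h0 := hM n
    have h1 := hM (n + 1)
    simp only [extendedM, if_neg hn, if_pos hn', add_sub_cancel_right] at h0 h1
    exact ⟨h0, by rw [h1]; ring⟩

theorem norm_caratheodory_extendedCMV_zero_le {α : ℤ → 𝔻} {z₀ : Circle} {ε B : ℝ} (hε : 0 < ε)
    (hε' : ε ≤ 1 / 6)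
    (hB : ∀ n : ℕ, (n : ℝ) ≤ ε⁻¹ →
      frobSq (transfer (fun j => szegoMatrix (α (j : ℤ)) z₀) n) ≤ B) (hB1 : 1 ≤ B) :
    ‖caratheodory (spectralMeasure (extendedCMV α) (lp.single 2 0 1)) ((1 - ε) * z₀)‖ ≤
      48000 * B := by
  have hzn := norm_one_sub_mul_circle (by linarith : ε < 1) z₀
  have hzr : ((1 - ε : ℂ)) * (z₀ : ℂ) = ((1 - ε : ℝ) : ℂ) * z₀ := by push_cast; ring
  rw [hzr] at hzn ⊢
  have hz1 : ‖((1 - ε : ℝ) : ℂ) * z₀‖ < 1 := by rw [hzn]; linarith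
  have hψ : ‖(lp.single 2 0 1 : ℓ²(ℤ, ℂ))‖ = 1 := norm_lpSingle_one 0
  obtain ⟨u, hu, hF⟩ := caratheodory_spectralMeasure (extendedCMV α) hψ hz1
  have hres := resolvent_norm_sq hψ hu
  rw [inner_lpSingle_one] at hF hres
  rw [hzn] at hres
  rw [hF]
  obtain ⟨heven, hodd⟩ := extendedCMV_resolvent hu
  refine norm_le_of_resolvent_zero (e := fun n : ℕ => (n : ℤ)) Nat.cast_injective (u := u)
    (v := (extendedM α).toUnitary u) (α := fun n : ℕ => α n) hε hε'
    (LinearIsometryEquiv.norm_map _ _) (one_le_two_mul_norm_resolvent hψ hz1 hu) ?_ ?_ hB hB1 rfl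
    hres
  · intro n hn
    have h := heven n ((Int.even_coe_nat n).2 hn)
    rw [if_neg (by omega : ¬ ((n : ℤ) + 1 = 0)), add_zero] at h
    simpa using h
  · intro n hn
    simpa using hodd n (by rwa [Int.even_coe_nat])

theorem norm_caratheodory_extendedCMV_one_le {α : ℤ → 𝔻} {z₀ : Circle} {ε B : ℝ} (hε : 0 < ε)
    (hε' : ε ≤ 1 / 6)
    (hB : ∀ n : ℕ, (n : ℝ) ≤ ε⁻¹ →
      frobSq (transfer (fun j => szegoMatrix (α ((1 + j : ℕ) : ℤ)) z₀) n) ≤ B) (hB1 : 1 ≤ B) :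
    ‖caratheodory (spectralMeasure (extendedCMV α) (lp.single 2 1 1)) ((1 - ε) * z₀)‖ ≤
      48000 * B := by
  have hzn := norm_one_sub_mul_circle (by linarith : ε < 1) z₀
  have hzr : ((1 - ε : ℂ)) * (z₀ : ℂ) = ((1 - ε : ℝ) : ℂ) * z₀ := by push_cast; ring
  rw [hzr] at hzn ⊢
  have hz1 : ‖((1 - ε : ℝ) : ℂ) * z₀‖ < 1 := by rw [hzn]; linarith
  have hψ : ‖(lp.single 2 1 1 : ℓ²(ℤ, ℂ))‖ = 1 := norm_lpSingle_one 1
  obtain ⟨u, hu, hF⟩ := caratheodory_spectralMeasure (extendedCMV α) hψ hz1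
  have hres := resolvent_norm_sq hψ hu
  rw [inner_lpSingle_one] at hF hres
  rw [hzn] at hres
  rw [hF]
  obtain ⟨heven, hodd⟩ := extendedCMV_resolvent hu
  refine norm_le_of_resolvent_one (e := fun n : ℕ => (n : ℤ)) Nat.cast_injective (u := u)
    (v := (extendedM α).toUnitary u) (α := fun n : ℕ => α n) hε hε'
    (LinearIsometryEquiv.norm_map _ _) ?_ ?_ hB hB1 (by rw [Nat.cast_one]) hres
  · intro n hn1 hn
    have h := heven n ((Int.even_coe_nat n).2 hn)
    have hn2 : n ≠ 1 := by rintro rfl; simp at hn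
    rw [if_neg (by omega : ¬ ((n : ℤ) + 1 = 1)), if_neg (by omega : ¬ ((n : ℤ) = 1)), add_zero,
      add_zero] at h
    simpa using h
  · intro n _ hn
    simpa using hodd n (by rwa [Int.even_coe_nat])

/-! ### Large `ε` and assembly of the three estimates. -/

theorem norm_caratheodory_le_of_forall_small (ν : Measure Circle) [IsProbabilityMeasure ν]
    {z₀ : Circle} {ε K G : ℝ} (hε' : ε < 1) (hG : 1 ≤ G) (hK : 12 ≤ K)
    (hsmall : ε ≤ 1 / 6 → ‖caratheodory ν ((1 - ε) * z₀)‖ ≤ K * G) :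
    ‖caratheodory ν ((1 - ε) * z₀)‖ ≤ K * G := by
  by_cases h : ε ≤ 1 / 6
  · exact hsmall h
  -- For `ε > 1 / 6` the trivial bound `2 / ε < 12` suffices.
  push Not at h
  have hzn := norm_one_sub_mul_circle hε' z₀
  refine (norm_caratheodory_le ν (by rw [hzn]; linarith)).trans ?_
  rw [hzn, sub_sub_cancel, div_le_iff₀ (by linarith)]
  have hKG : 12 ≤ K * G := by nlinarith
  nlinarith

theorem measure_arc_le_of_norm_le (ν : Measure Circle) [IsFiniteMeasure ν] {ζ ε K : ℝ}
    (hε : 0 < ε) (hε' : ε < 1) (h : ‖caratheodory ν ((1 - ε) * Circle.exp ζ)‖ ≤ K) :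
    ν (arc (ζ - ε) (ζ + ε)) ≤ ENNReal.ofReal (4 * ε * K) := by
  refine (measure_arc_le ν hε hε').trans (ENNReal.ofReal_le_ofReal ?_)
  exact mul_le_mul_of_nonneg_left ((re_le_norm _).trans h) (by positivity)

theorem proposition5p3 :
    ∃ C : ℝ, 0 < C ∧ ∃ c : ℝ, 0 < c ∧
      ∀ (d : ℕ) (h : UnitAddTorus (Fin d) → ℝ) (_ : IsAnalyticOnTorus h)
        (lam : Ioo (0 : ℝ) 1) (ω : Fin d → ℝ) (_ : RationallyIndependent ω)
        (x : UnitAddTorus (Fin d)) (ζ ε : ℝ) (_ : 0 < ε) (_ : ε < 1),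
        (∀ (φ : Circle) (ν : Measure Circle), IsProbabilityMeasure ν →
          HasVerblunskyCoefficients ν
            (fun n : ℕ => φ • verblunsky (sampling lam h) ω x (n : ℤ)) →
          ‖caratheodory ν ((1 - ε) * Circle.exp ζ)‖ ≤
            C * cocycleGrowth (sampling lam h) ω (Circle.exp ζ) (c * ε⁻¹)) ∧
        halfLineMeasure (fun n : ℕ => verblunsky (sampling lam h) ω x (n : ℤ))
            (arc (ζ - ε) (ζ + ε)) ≤
          ENNReal.ofReal
            (C * ε * cocycleGrowth (sampling lam h) ω (Circle.exp ζ) (c * ε⁻¹)) ∧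
        extendedMeasure (verblunsky (sampling lam h) ω x) (arc (ζ - ε) (ζ + ε)) ≤
          ENNReal.ofReal
            (C * ε * cocycleGrowth (sampling lam h) ω (Circle.exp ζ) (c * ε⁻¹)) := by
  -- An arc costs `4 · 48000 · 2 ≤ 400000` for each spectral measure at a basis vector, and
  -- `extendedMeasure` is a sum of two.
  refine ⟨800000, by norm_num, 1, one_pos, ?_⟩
  intro d h _ lam ω _ x ζ ε hε hε'
  rw [one_mul]
  set z₀ := Circle.exp ζ with hz₀
  set G := cocycleGrowth (sampling lam h) ω z₀ ε⁻¹ with hG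
  have hG1 : 1 ≤ G := one_le_cocycleGrowth lam h ω z₀ (inv_pos.2 hε).le
  have hB : ∀ k n : ℕ, (n : ℝ) ≤ ε⁻¹ → frobSq (transfer (fun j => szegoMatrix
      (verblunsky (sampling lam h) ω x ((k + j : ℕ) : ℤ)) z₀) n) ≤ 2 * G :=
    fun k n hn => frobSq_transfer_verblunsky_le lam h ω z₀ x k n hn
  have hB0 : ∀ n : ℕ, (n : ℝ) ≤ ε⁻¹ → frobSq (transfer (fun j : ℕ => szegoMatrix
      (verblunsky (sampling lam h) ω x (j : ℤ)) z₀) n) ≤ 2 * G := by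
    simpa only [zero_add] using hB 0
  have harc : ∀ ν : Measure Circle, IsProbabilityMeasure ν →
      (ε ≤ 1 / 6 → ‖caratheodory ν ((1 - ε) * z₀)‖ ≤ 48000 * (2 * G)) →
      ν (arc (ζ - ε) (ζ + ε)) ≤ ENNReal.ofReal (400000 * ε * G) := by
    intro ν hν hs
    have h1 := norm_caratheodory_le_of_forall_small ν (K := 96000) hε' hG1 (by norm_num)
      fun h => (hs h).trans (le_of_eq (by ring))
    refine (measure_arc_le_of_norm_le ν hε hε' h1).trans (ENNReal.ofReal_le_ofReal ?_)
    have : 0 ≤ ε * G := by positivity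
    nlinarith
  refine ⟨?_, ?_, ?_⟩
  · intro φ ν hν hver
    refine norm_caratheodory_le_of_forall_small ν hε' hG1 (by norm_num) fun hs => ?_
    refine (norm_caratheodory_le_of_verblunsky hver hε hs hB0).trans ?_
    linarith
  · refine (harc _ (isProbabilityMeasure_spectralMeasure _ (norm_lpSingle_one 0)) fun hs =>
      norm_caratheodory_halfLineMeasure_le hε hs hB0 (by linarith)).trans
      (ENNReal.ofReal_le_ofReal ?_)
    have : 0 ≤ ε * G := by positivity
    nlinarith
  · rw [extendedMeasure, Measure.add_apply]
    have h0 := harc _ (isProbabilityMeasure_spectralMeasure _ (norm_lpSingle_one 0)) fun hs =>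
      norm_caratheodory_extendedCMV_zero_le hε hs hB0 (by linarith)
    have h1 := harc _ (isProbabilityMeasure_spectralMeasure _ (norm_lpSingle_one 1)) fun hs =>
      norm_caratheodory_extendedCMV_one_le hε hs (hB 1) (by linarith)
    refine (add_le_add h0 h1).trans (le_of_eq ?_)
    rw [← ENNReal.ofReal_add (by positivity) (by positivity)]
    congr 1
    ring
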